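/- Represent a permutation $\sigma$ of $\{1,\dots,m\}$ by the set of points $(i,\sigma(i))$, $1\le i\le m$. A point $(i,\sigma(i))$ is external if it is a record, i.e. if $\sigma(i)$ is larger than all entries to its left, or smaller than all entries to its left, or larger than all entries to its right, or smaller than all entries to its right; otherwise it is internal. Let $Sq(n)$ be the set of permutations of size $n$ all of whose points are external, and let $ASq(n,k)$ be the set of permutations of size $n+k$ with exactly $n$ external points and exactly $k$ internal points. Write $a_n\sim b_n$ if $a_n/b_n\to 1$ as $n\to\infty$. **Theorem 1.1.** Let $(k_n)_{n\ge 0}$ be a sequence of non-negative integers with $k_n=o(\sqrt n)$, and write $k=k_n$. Then, as $n\to\infty$, $$|ASq(n,k)|\;\sim\;\frac{k!\,2^{k+1}\,n^{2k+1}\,4^{n-3}}{(2k+1)!}\;\sim\;\frac{k!\,2^{k}\,n^{2k}}{(2k+1)!}\,|Sq(n)|.$$ -/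

import Mathlib

open Filter Asymptotics

namespace AlmostSquare

/-- The entry at position `i` of `σ` is larger than every entry to its left. -/
def IsLeftToRightMax {m : ℕ} (σ : Equiv.Perm (Fin m)) (i : Fin m) : Prop :=
  ∀ j : Fin m, j < i → σ j < σ i

/-- The entry at position `i` of `σ` is smaller than every entry to its left. -/
def IsLeftToRightMin {m : ℕ} (σ : Equiv.Perm (Fin m)) (i : Fin m) : Prop :=
  ∀ j : Fin m, j < i → σ i < σ j

/-- The entry at position `i` of `σ` is larger than every entry to its right. -/
def IsRightToLeftMax {m : ℕ} (σ : Equiv.Perm (Fin m)) (i : Fin m) : Prop :=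
  ∀ j : Fin m, i < j → σ j < σ i

/-- The entry at position `i` of `σ` is smaller than every entry to its right. -/
def IsRightToLeftMin {m : ℕ} (σ : Equiv.Perm (Fin m)) (i : Fin m) : Prop :=
  ∀ j : Fin m, i < j → σ i < σ j

/-- The point `(i, σ i)` of the diagram of `σ` is external: it is a record (a maximum or a
minimum, from the left or from the right). -/
def IsExternal {m : ℕ} (σ : Equiv.Perm (Fin m)) (i : Fin m) : Prop :=
  IsLeftToRightMax σ i ∨ IsLeftToRightMin σ i ∨ IsRightToLeftMax σ i ∨ IsRightToLeftMin σ i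

/-- The point `(i, σ i)` of the diagram of `σ` is internal: it is not external. -/
def IsInternal {m : ℕ} (σ : Equiv.Perm (Fin m)) (i : Fin m) : Prop :=
  ¬ IsExternal σ i

/-- Square permutations of size `n`: every point is external. -/
def Sq (n : ℕ) : Set (Equiv.Perm (Fin n)) :=
  {σ | ∀ i : Fin n, IsExternal σ i}

/-- Almost square permutations of size `n + k` with exactly `n` external points and exactly
`k` internal points. -/
def ASq (n k : ℕ) : Set (Equiv.Perm (Fin (n + k))) :=
  {σ | {i : Fin (n + k) | IsExternal σ i}.ncard = n ∧
    {i : Fin (n + k) | IsInternal σ i}.ncard = k}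

end AlmostSquare

/-! Write m = n + k. Every external point lies on one of four monotone chains: upper or lower, left
or right. After ties are broken by a fixed precedence, it carries two bits: upper/lower, recorded by
a word x at its column, and left/right, recorded by a word y at its row. Once the first entry z is
fixed, the words x, y and a list q of the internal points determine the permutation
(`Compat.unique`). Conversely, a permutation has exactly 2^(k+2) · 2^(k+3) · k! compatible triples
(x, y, q), or half as many if z is the smallest or largest value: bits are free at the internal
points and at a few boundary places, and q may be ordered arbitrarily (`card_compat`). So, up to the
factor 32 · 4^k · k!, one counts triples.

For most pairs of words each letter occurs j/2 + O(√m) times among the first j places. The four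
chains then follow the sides of the tilted rectangle with corners (0, z), (z, 0), (m, m - z), (m -
z, m), of area 2z(m - z). Internal points must lie in a slight enlargement of it (`Compat.mem_fat`),
and any k points of a slight shrinking with distinct rows and columns, off row z, do occur
(`exists_compat`). Each z therefore has about 4^m (2z(m - z))^k triples, and the discrete beta
integral ∑ (z(m - z))^k ≈ k!²/(2k+1)! · m^(2k+1) (`le_sum_pow`, `sum_pow_le`) yields the formula.

A border of width s changes the area by a relative amount s/m, hence its k-th power by about ks/m;
as s is of order √m + k, this is negligible when k = o(√n). From below, Bernoulli's inequality and
the mean deviation of the words suffice. From above, the k-th power calls for exponential moments of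
the deviation, which come from a recursion for a reflected walk (`sum_cosh_maxUp_le`). Starts z
within εm of an end are negligible because their area is at most 2εm² while k!²/(2k+1)! ≥ 12^(-k) ≥
ε^k.

The second equivalence follows from the first at k = 0, since the all-external permutations are that
case. -/

namespace AlmostSquare

/-! ### Maxima of random walks and their moments. -/

/-- The number of elements of `A` smaller than `j`. -/
def cnt {m : ℕ} (A : Finset (Fin m)) (j : ℕ) : ℕ := (A.filter fun c => c.val < j).card

/-- The maximum of the walk which steps up at `true` and down at `false`. -/
def maxUp : (m : ℕ) → (Fin m → Bool) → ℕ
  | 0, _ => 0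
  | m + 1, x => if x 0 then maxUp m (fun i => x i.succ) + 1 else maxUp m (fun i => x i.succ) - 1

/-- Truncated subtraction in `maxUp` stops at 0, the height of the empty prefix, so `maxUp`
dominates the height ups - downs = 2 · ups - j of every prefix. -/
theorem cnt_le_maxUp {m : ℕ} (x : Fin m → Bool) (j : ℕ) (hj : j ≤ m) :
    2 * cnt (Finset.univ.filter fun c => x c = true) j ≤ j + maxUp m x := by
  induction m generalizing j with
  | zero => simp [cnt]
  | succ m ih =>
    rcases j with _ | j
    · simp [cnt]
    · have := ih (fun i => x i.succ) j (by omega)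
      simp only [cnt, Finset.filter_filter] at this ⊢
      rw [Fin.card_filter_univ_succ]
      simp only [maxUp, Fin.val_succ, Fin.val_zero,
        Nat.zero_lt_succ, and_true, add_lt_add_iff_right]
      split_ifs <;> omega

theorem cnt_true_add_cnt_false {m : ℕ} (x : Fin m → Bool) (j : ℕ) (hj : j ≤ m) :
    cnt (Finset.univ.filter fun c => x c = true) j +
      cnt (Finset.univ.filter fun c => x c = false) j = j := by
  unfold cnt
  rw [← Finset.card_union_of_disjoint]
  · rw [← Finset.filter_union]
    have : (Finset.univ.filter fun c : Fin m => x c = true) ∪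
        (Finset.univ.filter fun c => x c = false) = Finset.univ := by
      ext c; cases h : x c <;> simp [h]
    rw [this, Fin.card_filter_val_lt, min_eq_right hj]
  · rw [Finset.disjoint_left]
    intro c hc
    simp only [Finset.mem_filter, Finset.mem_univ, true_and] at hc ⊢
    simp [hc.1]

/-- A bound for the deviation of the walk from `0` in both directions. -/
def dev {m : ℕ} (x : Fin m → Bool) : ℕ := maxUp m x + maxUp m (fun c => !x c)

theorem two_mul_cnt_le {m : ℕ} (x : Fin m → Bool) (j : ℕ) (hj : j ≤ m) :
    2 * cnt (Finset.univ.filter fun c => x c = true) j ≤ j + dev x := by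
  have := cnt_le_maxUp x j hj
  unfold dev; omega

theorem le_two_mul_cnt {m : ℕ} (x : Fin m → Bool) (j : ℕ) (hj : j ≤ m) :
    j ≤ 2 * cnt (Finset.univ.filter fun c => x c = true) j + dev x := by
  have h1 := cnt_le_maxUp (fun c => !x c) j hj
  have h2 := cnt_true_add_cnt_false x j hj
  simp only [Bool.not_eq_true'] at h1
  unfold dev; omega

theorem maxUp_le {m : ℕ} (x : Fin m → Bool) : maxUp m x ≤ m := by
  induction m with
  | zero => simp [maxUp]
  | succ m ih =>
    have := ih (fun i => x i.succ)
    simp only [maxUp]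
    split_ifs <;> omega

theorem dev_le {m : ℕ} (x : Fin m → Bool) : dev x ≤ 2 * m := by
  have := maxUp_le x
  have := maxUp_le (fun c => !x c)
  unfold dev; omega

/-- One step of a walk reflected at 0. For M ≥ 1 the addition formulas give equality; at M = 0 the
truncated step stays at 0, which costs only 1 ≤ cosh θ. -/
theorem cosh_step (θ : ℝ) (M : ℕ) :
    Real.cosh (θ * ((M + 1 : ℕ) : ℝ)) + Real.cosh (θ * ((M - 1 : ℕ) : ℝ)) ≤
      2 * Real.cosh θ * Real.cosh (θ * M) := by
  rcases M with _ | M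
  · have := Real.one_le_cosh θ
    simp; linarith
  · have e1 : θ * ((M + 1 + 1 : ℕ) : ℝ) = θ * ((M + 1 : ℕ) : ℝ) + θ := by push_cast; ring
    have e2 : θ * ((M + 1 - 1 : ℕ) : ℝ) = θ * ((M + 1 : ℕ) : ℝ) - θ := by
      simp; ring
    rw [e1, e2, Real.cosh_add, Real.cosh_sub]
    linarith

/-- Prepending a letter moves the maximum like a walk reflected at 0, so each letter multiplies the
total by at most 2 cosh θ. -/
theorem sum_cosh_maxUp_le (θ : ℝ) (m : ℕ) :
    ∑ x : Fin m → Bool, Real.cosh (θ * maxUp m x) ≤ (2 * Real.cosh θ) ^ m := by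
  induction m with
  | zero => simp [maxUp]
  | succ m ih =>
    rw [← (Fin.consEquiv (fun _ : Fin (m + 1) => Bool)).sum_comp, Fintype.sum_prod_type]
    rw [Fintype.sum_bool, ← Finset.sum_add_distrib]
    calc _ ≤ ∑ x : Fin m → Bool, 2 * Real.cosh θ * Real.cosh (θ * maxUp m x) := by
          apply Finset.sum_le_sum
          intro x _
          simpa [Fin.consEquiv, maxUp] using cosh_step θ (maxUp m x)
      _ ≤ _ := by
          rw [← Finset.mul_sum, pow_succ']
          have := Real.cosh_pos θ
          gcongr

theorem cosh_pow_le (θ : ℝ) (m : ℕ) : Real.cosh θ ^ m ≤ Real.exp (m * θ ^ 2 / 2) := by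
  calc Real.cosh θ ^ m ≤ Real.exp (θ ^ 2 / 2) ^ m := by
        have := Real.cosh_pos θ
        gcongr
        exact Real.cosh_le_exp_half_sq θ
    _ = _ := by rw [← Real.exp_nat_mul]; congr 1; ring

theorem sum_cosh_maxUp_le_exp (θ : ℝ) (m : ℕ) :
    ∑ x : Fin m → Bool, Real.cosh (θ * maxUp m x) ≤ 2 ^ m * Real.exp (m * θ ^ 2 / 2) := by
  refine (sum_cosh_maxUp_le θ m).trans ?_
  rw [mul_pow]
  gcongr
  exact cosh_pow_le θ m

/-- Only cosh moments are controlled, and exp ≤ 2 cosh would lose a factor 2 in the limit. Instead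
exp = cosh + sinh, and AM-GM bounds sinh by η/2 plus a multiple of sinh², which is again a cosh. The
resulting moment bound tends to 1 + η/2 as mθ² → 0, with η free. -/
theorem exp_le_cosh_add (t η : ℝ) (hη : 0 < η) :
    Real.exp t ≤ Real.cosh t + η / 2 + (Real.cosh (2 * t) - 1) / (4 * η) := by
  have h1 : Real.cosh (2 * t) - 1 = 2 * Real.sinh t ^ 2 := by
    rw [Real.cosh_two_mul, Real.cosh_sq]; ring
  have h2 : Real.sinh t ≤ η / 2 + (2 * Real.sinh t ^ 2) / (4 * η) := by
    have : η / 2 + (2 * Real.sinh t ^ 2) / (4 * η) - Real.sinh t =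
        (η - Real.sinh t) ^ 2 / (2 * η) := by field_simp; ring
    have : 0 ≤ (η - Real.sinh t) ^ 2 / (2 * η) := by positivity
    linarith
  rw [h1, ← Real.cosh_add_sinh]
  linarith

theorem sum_exp_maxUp_le (θ η : ℝ) (hη : 0 < η) (m : ℕ) :
    ∑ x : Fin m → Bool, Real.exp (θ * maxUp m x) ≤
      2 ^ m * (Real.exp (m * θ ^ 2 / 2) + η / 2 +
        (Real.exp (2 * (m * θ ^ 2)) - 1) / (4 * η)) := by
  calc _ ≤ ∑ x : Fin m → Bool, (Real.cosh (θ * maxUp m x) + η / 2 +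
          (Real.cosh ((2 * θ) * maxUp m x) - 1) / (4 * η)) := by
        apply Finset.sum_le_sum
        intro x _
        rw [mul_assoc]
        exact exp_le_cosh_add _ _ hη
    _ = ∑ x : Fin m → Bool, Real.cosh (θ * maxUp m x) + 2 ^ m * (η / 2) +
          (∑ x : Fin m → Bool, Real.cosh ((2 * θ) * maxUp m x) - 2 ^ m) / (4 * η) := by
        simp only [Finset.sum_add_distrib, ← Finset.sum_div, Finset.sum_sub_distrib,
          Finset.sum_const, Finset.card_univ, Fintype.card_pi, Fintype.card_bool,
          Finset.prod_const, Fintype.card_fin, nsmul_eq_mul]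
        push_cast
        ring
    _ ≤ 2 ^ m * Real.exp (m * θ ^ 2 / 2) + 2 ^ m * (η / 2) +
          (2 ^ m * Real.exp (m * (2 * θ) ^ 2 / 2) - 2 ^ m) / (4 * η) := by
        gcongr
        · exact sum_cosh_maxUp_le_exp θ m
        · exact sum_cosh_maxUp_le_exp (2 * θ) m
    _ = _ := by
        have : (m : ℝ) * (2 * θ) ^ 2 / 2 = 2 * (m * θ ^ 2) := by ring
        rw [this]; ring

theorem sum_comp_not {m : ℕ} (f : (Fin m → Bool) → ℝ) :
    ∑ x : Fin m → Bool, f (fun c => !x c) = ∑ x : Fin m → Bool, f x :=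
  (Equiv.arrowCongr (Equiv.refl (Fin m)) Equiv.boolNot).sum_comp f

/-- AM-GM, used to separate the maxima of x, of y and of their complements: a word and its
complement are dependent, and this avoids their joint law at the price of a factor 4 in the
exponent. -/
theorem exp_add_four_le (a b c d : ℝ) :
    Real.exp (a + b + (c + d)) ≤
      (Real.exp (4 * a) + Real.exp (4 * b) + Real.exp (4 * c) + Real.exp (4 * d)) / 4 := by
  have key : ∀ u v : ℝ, Real.exp (u + v) ≤ (Real.exp (2 * u) + Real.exp (2 * v)) / 2 := by
    intro u v
    rw [Real.exp_add, two_mul, two_mul, Real.exp_add, Real.exp_add]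
    nlinarith [sq_nonneg (Real.exp u - Real.exp v)]
  have h1 := key (a + b) (c + d)
  have h2 := key (2 * a) (2 * b)
  have h3 := key (2 * c) (2 * d)
  rw [← mul_add] at h2 h3
  have e : ∀ t : ℝ, 2 * (2 * t) = 4 * t := fun t => by ring
  rw [e, e] at h2 h3
  linarith

theorem sum_exp_dev_add_dev_le (θ : ℝ) (m : ℕ) :
    ∑ x : Fin m → Bool, ∑ y : Fin m → Bool, Real.exp (θ * ((dev x : ℝ) + dev y)) ≤
      2 ^ m * ∑ x : Fin m → Bool, Real.exp (4 * θ * maxUp m x) := by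
  set f : (Fin m → Bool) → ℝ := fun x => Real.exp (4 * θ * maxUp m x) with hf
  have hn : ∑ x : Fin m → Bool, f (fun c => !x c) = ∑ x : Fin m → Bool, f x := sum_comp_not f
  calc _ ≤ ∑ x : Fin m → Bool, ∑ y : Fin m → Bool,
        (f x + f (fun c => !x c) + f y + f (fun c => !y c)) / 4 := by
        apply Finset.sum_le_sum; intro x _
        apply Finset.sum_le_sum; intro y _
        have := exp_add_four_le (θ * maxUp m x) (θ * maxUp m (fun c => !x c)) (θ * maxUp m y)
          (θ * maxUp m (fun c => !y c))
        simp only [hf, dev]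
        push_cast
        simp only [← mul_assoc] at this
        rw [mul_add, mul_add, mul_add]
        exact this
    _ = _ := by
        simp only [← Finset.sum_div, Finset.sum_add_distrib, Finset.sum_const, Finset.card_univ,
          Fintype.card_pi, Fintype.card_bool, Finset.prod_const, Fintype.card_fin, nsmul_eq_mul,
          ← Finset.mul_sum, hn]
        push_cast
        ring

/-- Take θ = 1/√m in the cosh moment, where it is bounded by a constant, and use t ≤ exp t ≤ 2 cosh
t for t = `maxUp`/√m. -/
theorem sum_maxUp_le (m : ℕ) : ∑ x : Fin m → Bool, (maxUp m x : ℝ) ≤ 2 ^ m * (4 * √m) := by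
  rcases Nat.eq_zero_or_pos m with rfl | hm
  · simp [maxUp]
  have hs : 0 < √(m : ℝ) := by positivity
  have h := sum_cosh_maxUp_le_exp (1 / √m) m
  have e : (m : ℝ) * (1 / √m) ^ 2 / 2 = 1 / 2 := by
    rw [div_pow, Real.sq_sqrt (by positivity)]; field_simp
  rw [e] at h
  have he : Real.exp (1 / 2) ≤ 2 := by
    have h1 : Real.exp (1 / 2) ^ 2 = Real.exp 1 := by
      rw [← Real.exp_nat_mul]; norm_num
    nlinarith [Real.exp_one_lt_d9, Real.exp_pos (1 / 2)]
  calc _ ≤ ∑ x : Fin m → Bool, √m * (2 * Real.cosh (1 / √m * maxUp m x)) := by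
        apply Finset.sum_le_sum; intro x _
        set t : ℝ := 1 / √m * maxUp m x
        have ht : (maxUp m x : ℝ) = √m * t := by simp only [t]; field_simp
        have h1 := Real.add_one_le_exp t
        have h2 : Real.exp t ≤ 2 * Real.cosh t := by
          rw [Real.cosh_eq]; have := Real.exp_pos (-t); linarith
        rw [ht]
        gcongr
        linarith
    _ ≤ √m * (2 * (2 ^ m * 2)) := by
        rw [← Finset.mul_sum, ← Finset.mul_sum]
        gcongr
        exact h.trans (by gcongr)
    _ = _ := by ring

theorem sum_dev_add_dev_le (m : ℕ) :
    ∑ x : Fin m → Bool, ∑ y : Fin m → Bool, ((dev x : ℝ) + dev y) ≤ 4 ^ m * (16 * √m) := by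
  have hn : ∑ x : Fin m → Bool, (maxUp m (fun c => !x c) : ℝ) =
      ∑ x : Fin m → Bool, (maxUp m x : ℝ) := sum_comp_not fun x => (maxUp m x : ℝ)
  have h := sum_maxUp_le m
  simp only [dev, Nat.cast_add, Finset.sum_add_distrib, Finset.sum_const, Finset.card_univ,
    Fintype.card_pi, Fintype.card_bool, Finset.prod_const, Fintype.card_fin, nsmul_eq_mul,
    ← Finset.mul_sum, hn]
  push_cast
  have e : (4 : ℝ) ^ m = 2 ^ m * 2 ^ m := by rw [← mul_pow]; norm_num
  rw [e]
  have := mul_le_mul_of_nonneg_left h (by positivity : (0 : ℝ) ≤ 2 ^ m)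
  nlinarith

/-! ### Lattice points near and inside the tilted rectangle. -/

/-- The points of the grid at distance at most about `s` from the tilted rectangle with corners
`(0, z)`, `(z, 0)`, `(m, m - z)`, `(m - z, m)`. -/
def fat (m z s : ℕ) : Finset (Fin m × Fin m) :=
  Finset.univ.filter fun q => q.2.val ≤ q.1.val + z + s ∧ q.1.val ≤ q.2.val + z + s ∧
    z ≤ q.1.val + q.2.val + s ∧ q.1.val + q.2.val + z ≤ 2 * m + s

/-- The points of the grid inside that tilted rectangle, at distance at least about `s` from
its boundary. -/
def thin (m z s : ℕ) : Finset (Fin m × Fin m) :=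
  Finset.univ.filter fun q => q.2.val + s ≤ q.1.val + z ∧ q.1.val + s ≤ q.2.val + z ∧
    z + s ≤ q.1.val + q.2.val ∧ q.1.val + q.2.val + z + s ≤ 2 * m

theorem card_fat_le (m z s : ℕ) (hz : z ≤ m) :
    (fat m z s).card ≤ (2 * z + 2 * s + 1) * (m - z + s + 1) := by
  have : (Finset.range (2 * z + 2 * s + 1) ×ˢ Finset.range (m - z + s + 1)).card =
      (2 * z + 2 * s + 1) * (m - z + s + 1) := by simp
  rw [← this]
  apply Finset.card_le_card_of_injOn
    -- Coordinates along the sides: the shifted difference and half the shifted sum. Halving loses a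
    -- parity, but the difference already fixes it, so the map stays injective.
    (fun q => (q.2.val + z + s - q.1.val, (q.1.val + q.2.val + s - z) / 2))
  · intro q hq
    simp only [fat, Finset.coe_filter, Finset.mem_univ, true_and, Set.mem_ofPred_eq] at hq
    simp only [Finset.coe_product, Finset.coe_range, Set.mem_prod, Set.mem_Iio]
    omega
  · intro q hq q' hq' h
    simp only [fat, Finset.coe_filter, Finset.mem_univ, true_and, Set.mem_ofPred_eq] at hq hq'
    simp only [Prod.mk.injEq] at h
    ext <;> omega

theorem card_fat_le_real (m z s D : ℕ) (hz : z ≤ m) (hm : 1 ≤ m) (hs : 1 ≤ s) (hD : s ≤ D * m) :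
    ((fat m z s).card : ℝ) ≤ 2 * z * (m - z) + (10 + 3 * D) * m * s := by
  have h : ((fat m z s).card : ℝ) ≤ ((2 * z + 2 * s + 1) * (m - z + s + 1) : ℕ) := by
    exact_mod_cast card_fat_le m z s hz
  refine h.trans ?_
  push_cast [Nat.cast_sub hz]
  have hz' : (z : ℝ) ≤ m := by exact_mod_cast hz
  have hz0 : (0 : ℝ) ≤ z := by positivity
  have hm' : (1 : ℝ) ≤ m := by exact_mod_cast hm
  have hs' : (1 : ℝ) ≤ s := by exact_mod_cast hs
  have hD' : (s : ℝ) ≤ D * m := by exact_mod_cast hD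
  have h1 : (2 * s + 1 : ℝ) * (m - z + s + 1) ≤ (3 * s) * (m + D * m + m) := by
    apply mul_le_mul <;> nlinarith
  have h2 : (2 * z : ℝ) * (s + 1) ≤ 2 * m * (2 * s) := by
    apply mul_le_mul <;> nlinarith
  nlinarith

theorem le_card_thin (m z s : ℕ) (hs : 1 ≤ s) (h1 : s ≤ z) (h2 : s + z ≤ m) :
    (2 * (z - s) + 1) * (m - z - s) ≤ (thin m z s).card := by
  have : (Finset.range (2 * (z - s) + 1) ×ˢ Finset.range (m - z - s)).card =
      (2 * (z - s) + 1) * (m - z - s) := by simp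
  rw [← this]
  apply Finset.card_le_card_of_injOn
    -- The first index is the shifted difference of the coordinates and the second a position along
    -- the diagonal, starting at the side where their sum is about z + s. The `else` value is a
    -- dummy, never reached from the box.
    (fun ij => if h : (2 * z - ij.1 + 1) / 2 + ij.2 < m ∧
        (2 * z - ij.1 + 1) / 2 + ij.2 + ij.1 + s - z < m then
      (⟨(2 * z - ij.1 + 1) / 2 + ij.2, h.1⟩, ⟨(2 * z - ij.1 + 1) / 2 + ij.2 + ij.1 + s - z, h.2⟩)
      else (⟨0, by omega⟩, ⟨0, by omega⟩))
  · intro ij hij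
    simp only [Finset.coe_product, Finset.coe_range, Set.mem_prod, Set.mem_Iio] at hij
    dsimp only
    rw [dif_pos (by omega)]
    simp only [thin, Finset.coe_filter, Finset.mem_univ, true_and, Set.mem_ofPred_eq]
    omega
  · intro a ha b hb h
    simp only [Finset.coe_product, Finset.coe_range, Set.mem_prod, Set.mem_Iio] at ha hb
    dsimp only at h
    rw [dif_pos (by omega), dif_pos (by omega)] at h
    simp only [Prod.mk.injEq, Fin.mk.injEq] at h
    ext <;> omega

theorem le_card_thin_real (m z s : ℕ) (hz : z ≤ m) (hs : 1 ≤ s) :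
    2 * (z : ℝ) * (m - z) - 2 * m * s ≤ ((thin m z s).card : ℝ) := by
  have hz' : (z : ℝ) ≤ m := by exact_mod_cast hz
  have hz0 : (0 : ℝ) ≤ z := by positivity
  have hs0 : (0 : ℝ) ≤ s := by positivity
  by_cases h1 : s ≤ z
  · by_cases h2 : s + z ≤ m
    · have h : (((2 * (z - s) + 1) * (m - z - s) : ℕ) : ℝ) ≤ ((thin m z s).card : ℝ) := by
        exact_mod_cast le_card_thin m z s hs h1 h2
      refine le_trans ?_ h
      push_cast [Nat.cast_sub h1, Nat.cast_sub hz, Nat.cast_sub (show s ≤ m - z by omega)]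
      have h2' : (s : ℝ) + z ≤ m := by exact_mod_cast h2
      nlinarith
    · have h2' : (m : ℝ) ≤ s + z := by exact_mod_cast (by omega : m ≤ s + z)
      have : (0 : ℝ) ≤ (thin m z s).card := by positivity
      nlinarith
  · have h2' : (z : ℝ) ≤ s := by exact_mod_cast (by omega : z ≤ s)
    have : (0 : ℝ) ≤ (thin m z s).card := by positivity
    nlinarith

/-! ### Sequences of non-attacking points. -/

/-- The sequences in `A` with distinct columns and distinct rows. -/
def rookSeqs {m : ℕ} (A : Finset (Fin m × Fin m)) (k : ℕ) : Finset (Fin k → Fin m × Fin m) :=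
  Finset.univ.filter fun q => (∀ i, q i ∈ A) ∧ Function.Injective (fun i => (q i).1) ∧
    Function.Injective (fun i => (q i).2)

/-- The points already chosen block at most k columns and k rows, of m cells each. -/
theorem card_sub_le_card_filter_rook {m k : ℕ} (A : Finset (Fin m × Fin m))
    (q : Fin k → Fin m × Fin m) :
    A.card - 2 * k * m ≤
      (A.filter fun a => (∀ i, (q i).1 ≠ a.1) ∧ ∀ i, (q i).2 ≠ a.2).card := by
  have hsub : A ⊆ (A.filter fun a => (∀ i, (q i).1 ≠ a.1) ∧ ∀ i, (q i).2 ≠ a.2) ∪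
      ((Finset.univ.image (fun i => (q i).1) ×ˢ Finset.univ) ∪
        (Finset.univ ×ˢ Finset.univ.image (fun i => (q i).2))) := by
    intro a ha
    simp only [Finset.mem_union, Finset.mem_filter, ha, true_and, Finset.mem_product,
      Finset.mem_image, Finset.mem_univ, and_true]
    by_cases h1 : ∃ i, (q i).1 = a.1
    · exact Or.inr (Or.inl h1)
    · by_cases h2 : ∃ i, (q i).2 = a.2
      · exact Or.inr (Or.inr h2)
      · push Not at h1 h2
        exact Or.inl ⟨h1, h2⟩
  have h := (Finset.card_le_card hsub).trans
    ((Finset.card_union_le _ _).trans (Nat.add_le_add_left (Finset.card_union_le _ _) _))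
  rw [Finset.card_product, Finset.card_product] at h
  have c1 : (Finset.univ.image (fun i => (q i).1)).card ≤ k := by
    simpa using Finset.card_image_le (s := Finset.univ) (f := fun i => (q i).1)
  have c2 : (Finset.univ.image (fun i => (q i).2)).card ≤ k := by
    simpa using Finset.card_image_le (s := Finset.univ) (f := fun i => (q i).2)
  have c1' := Nat.mul_le_mul_right m c1
  have c2' := Nat.mul_le_mul_left m c2
  simp only [Finset.card_univ, Fintype.card_fin] at h
  have e : 2 * k * m = k * m + m * k := by ring
  omega

/-- Choose the points one by one. The bound K on the final length is kept apart from k so that the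
number of choices per step stays fixed in the induction. -/
theorem pow_le_card_rookSeqs {m : ℕ} (A : Finset (Fin m × Fin m)) (K k : ℕ) (hk : k ≤ K) :
    (A.card - 2 * K * m) ^ k ≤ (rookSeqs A k).card := by
  induction k with
  | zero => simp [rookSeqs, Function.Injective]
  | succ k ih =>
    have ih := ih (by omega)
    set S := (rookSeqs A k).sigma fun q =>
      A.filter fun a => (∀ i, (q i).1 ≠ a.1) ∧ ∀ i, (q i).2 ≠ a.2 with hS
    have hcard : (A.card - 2 * K * m) ^ (k + 1) ≤ S.card := by
      rw [hS, Finset.card_sigma, pow_succ]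
      calc _ ≤ (rookSeqs A k).card * (A.card - 2 * K * m) := Nat.mul_le_mul_right _ ih
        _ = ∑ q ∈ rookSeqs A k, (A.card - 2 * K * m) := by simp
        _ ≤ _ := by
          apply Finset.sum_le_sum
          intro q _
          refine le_trans ?_ (card_sub_le_card_filter_rook A q)
          have : 2 * k * m ≤ 2 * K * m := by gcongr; omega
          omega
    refine hcard.trans ?_
    apply Finset.card_le_card_of_injOn (fun a => (Fin.cons a.2 a.1 : Fin (k + 1) → Fin m × Fin m))
    · rintro ⟨q, a⟩ h
      simp only [hS, Finset.coe_sigma, Set.mem_sigma_iff, Finset.mem_coe, rookSeqs,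
        Finset.mem_filter, Finset.mem_univ, true_and] at h
      obtain ⟨⟨hA, h1, h2⟩, ha, h3, h4⟩ := h
      simp only [rookSeqs, Finset.coe_filter, Finset.mem_univ, true_and, Set.mem_ofPred_eq]
      refine ⟨?_, ?_, ?_⟩
      · intro i; refine Fin.cases ?_ (fun i => ?_) i
        · simpa using ha
        · simpa using hA i
      · intro i j
        refine Fin.cases ?_ (fun i => ?_) i <;> refine Fin.cases ?_ (fun j => ?_) j
        · simp
        · simpa using fun h => (h3 j h.symm).elim
        · simpa using fun h => (h3 i h).elim
        · simpa using fun h => h1 h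
      · intro i j
        refine Fin.cases ?_ (fun i => ?_) i <;> refine Fin.cases ?_ (fun j => ?_) j
        · simp
        · simpa using fun h => (h4 j h.symm).elim
        · simpa using fun h => (h4 i h).elim
        · simpa using fun h => h2 h
    · rintro ⟨q, a⟩ _ ⟨q', a'⟩ _ h
      have h := Fin.cons_inj.1 h
      simp only at h
      obtain ⟨rfl, rfl⟩ := h
      rfl

/-! ### Balanced sets, and the encoding of a permutation by two words. -/

/-- `A` has about `j / 2` elements below each `j`. -/
def Balanced {m : ℕ} (A : Finset (Fin m)) (s : ℕ) : Prop :=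
  ∀ j ≤ m, j ≤ 2 * cnt A j + s ∧ 2 * cnt A j ≤ j + s

theorem cnt_le_cnt_add_card {m : ℕ} {A B E : Finset (Fin m)} (h : A ⊆ B ∪ E) (j : ℕ) :
    cnt A j ≤ cnt B j + E.card := by
  unfold cnt
  refine (Finset.card_le_card (?_ : A.filter _ ⊆ (B.filter fun c => c.val < j) ∪ E)).trans
    (Finset.card_union_le _ _)
  intro c hc
  simp only [Finset.mem_filter] at hc
  have := h hc.1
  simp only [Finset.mem_union, Finset.mem_filter] at this ⊢
  tauto

/-- Correcting at most e places changes each count by at most e, hence twice the count by at most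
2e. -/
theorem balanced_of_label {m e : ℕ} (x : Fin m → Bool) (b : Bool) (A E : Finset (Fin m))
    (hE : E.card ≤ e) (h : ∀ c ∉ E, (c ∈ A ↔ x c = b)) : Balanced A (dev x + 2 * e) := by
  intro j hj
  have h1 := two_mul_cnt_le x j hj
  have h2 := le_two_mul_cnt x j hj
  have h3 := cnt_true_add_cnt_false x j hj
  have h4 : cnt A j ≤ cnt (Finset.univ.filter fun c => x c = b) j + E.card := by
    apply cnt_le_cnt_add_card
    intro c hc
    by_cases hcE : c ∈ E
    · simp [hcE]
    · simp [(h c hcE).1 hc]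
  have h5 : cnt (Finset.univ.filter fun c => x c = b) j ≤ cnt A j + E.card := by
    apply cnt_le_cnt_add_card
    intro c hc
    by_cases hcE : c ∈ E
    · simp [hcE]
    · simp only [Finset.mem_filter, Finset.mem_univ, true_and] at hc
      simp [(h c hcE).2 hc]
  cases b <;> omega

/-- An external point in column `c` is labelled as belonging to one of the two upper chains. -/
def IsUpper {m : ℕ} (σ : Equiv.Perm (Fin m)) (c : Fin m) : Prop :=
  ¬ IsLeftToRightMin σ c ∧ (IsLeftToRightMax σ c ∨ ¬ IsRightToLeftMin σ c)

/-- An external point in column `c` is labelled as belonging to one of the two left chains. -/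
def IsLeft {m : ℕ} (σ : Equiv.Perm (Fin m)) (c : Fin m) : Prop :=
  IsLeftToRightMin σ c ∨ IsLeftToRightMax σ c

/-- The word `x` records which columns are upper, `y` which rows are left, except at internal
points and at some boundary points, and `q` lists the internal points. -/
structure Compat {m k : ℕ} (σ : Equiv.Perm (Fin m)) (x y : Fin m → Bool)
    (q : Fin k → Fin m × Fin m) : Prop where
  inj : Function.Injective fun i => (q i).1
  internal : ∀ c, IsInternal σ c ↔ ∃ i, (q i).1 = c
  snd_eq : ∀ i, (q i).2 = σ (q i).1
  upper : ∀ c, IsExternal σ c → c.val ≠ 0 → c.val + 1 ≠ m → (x c = true ↔ IsUpper σ c)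
  left : ∀ c, IsExternal σ c → c.val ≠ 0 → (σ c).val ≠ 0 → (σ c).val + 1 ≠ m →
    (y (σ c) = true ↔ IsLeft σ c)

theorem isLeftToRightMin_zero {m : ℕ} [NeZero m] (σ : Equiv.Perm (Fin m)) :
    IsLeftToRightMin σ 0 := fun j hj => absurd hj (Fin.not_lt_zero j)

theorem isLeftToRightMin_of_eq_zero {m : ℕ} (σ : Equiv.Perm (Fin m)) (c : Fin m)
    (h : (σ c).val = 0) : IsLeftToRightMin σ c := by
  intro j hj
  have : σ j ≠ σ c := fun e => hj.ne (σ.injective e)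
  rw [Fin.lt_def]
  have := Fin.val_ne_of_ne this
  omega

theorem isLeftToRightMax_of_eq_last {m : ℕ} (σ : Equiv.Perm (Fin m)) (c : Fin m)
    (h : (σ c).val + 1 = m) : IsLeftToRightMax σ c := by
  intro j hj
  have : σ j ≠ σ c := fun e => hj.ne (σ.injective e)
  rw [Fin.lt_def]
  have := Fin.val_ne_of_ne this
  omega

theorem isExternal_last {m : ℕ} (σ : Equiv.Perm (Fin m)) (c : Fin m) (h : c.val + 1 = m) :
    IsExternal σ c := by
  refine Or.inr (Or.inr (Or.inl ?_))
  intro j hj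
  rw [Fin.lt_def] at hj
  omega

/-- The two labels break ties by the precedence left-to-right minimum, left-to-right maximum,
right-to-left minimum, right-to-left maximum. This and the next two lemmas recover the kind of
record from the labels. -/
theorem IsExternal.isRightToLeftMax {m : ℕ} {σ : Equiv.Perm (Fin m)} {c : Fin m}
    (h : IsExternal σ c) (hU : IsUpper σ c) (hL : ¬ IsLeft σ c) : IsRightToLeftMax σ c := by
  unfold IsExternal IsUpper IsLeft at *
  tauto

theorem IsUpper.isLeftToRightMax {m : ℕ} {σ : Equiv.Perm (Fin m)} {c : Fin m}
    (hU : IsUpper σ c) (hL : IsLeft σ c) : IsLeftToRightMax σ c := by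
  unfold IsUpper IsLeft at *
  tauto

theorem isRightToLeftMin_of_not {m : ℕ} {σ : Equiv.Perm (Fin m)} {c : Fin m}
    (hU : ¬ IsUpper σ c) (hL : ¬ IsLeft σ c) : IsRightToLeftMin σ c := by
  unfold IsUpper IsLeft at *
  tauto

theorem IsLeft.isLeftToRightMin {m : ℕ} [NeZero m] {σ : Equiv.Perm (Fin m)} {c : Fin m}
    (hL : IsLeft σ c) (h : σ c ≤ σ 0) : IsLeftToRightMin σ c := by
  rcases hL with hL | hL
  · exact hL
  · rcases eq_or_ne c 0 with rfl | hc
    · exact isLeftToRightMin_zero σ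
    · exact absurd (hL 0 (Fin.pos_iff_ne_zero.2 hc)) (not_lt.2 h)

theorem IsLeft.isLeftToRightMax {m : ℕ} [NeZero m] {σ : Equiv.Perm (Fin m)} {c : Fin m}
    (hL : IsLeft σ c) (h : σ 0 < σ c) : IsLeftToRightMax σ c := by
  rcases hL with hL | hL
  · rcases eq_or_ne c 0 with rfl | hc
    · exact absurd h (lt_irrefl _)
    · exact absurd (hL 0 (Fin.pos_iff_ne_zero.2 hc)) (not_lt.2 h.le)
  · exact hL

/-- The first entry separates the two left chains: the maxima start above it, while the minima start
at it and descend. -/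
theorem IsLeft.isUpper_iff {m : ℕ} [NeZero m] {σ : Equiv.Perm (Fin m)} {c : Fin m}
    (hL : IsLeft σ c) : IsUpper σ c ↔ σ 0 < σ c := by
  constructor
  · intro hU
    have h1 := hU.isLeftToRightMax hL
    rcases eq_or_ne c 0 with rfl | hc
    · exact absurd (isLeftToRightMin_zero σ) hU.1
    · exact h1 0 (Fin.pos_iff_ne_zero.2 hc)
  · intro h
    refine ⟨fun hmin => ?_, Or.inl (hL.isLeftToRightMax h)⟩
    rcases eq_or_ne c 0 with rfl | hc
    · exact absurd h (lt_irrefl _)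
    · exact absurd (hmin 0 (Fin.pos_iff_ne_zero.2 hc)) (not_lt.2 h.le)

/-! ### The first entry and the encoding determine the permutation. -/

section Unique
variable {m k : ℕ} {σ τ : Equiv.Perm (Fin m)} {x y : Fin m → Bool}
  {q : Fin k → Fin m × Fin m}

theorem Compat.apply_eq_of_internal (hσ : Compat σ x y q) (hτ : Compat τ x y q) {c : Fin m}
    (h : IsInternal σ c) : σ c = τ c := by
  obtain ⟨i, rfl⟩ := (hσ.internal c).1 h
  rw [← hσ.snd_eq, ← hτ.snd_eq]

theorem Compat.external_iff (hσ : Compat σ x y q) (hτ : Compat τ x y q) (c : Fin m) :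
    IsExternal σ c ↔ IsExternal τ c :=
  not_iff_not.1 ((hσ.internal c).trans (hτ.internal c).symm)

variable [NeZero m]

/-- Left/right labels belong to rows, so they transfer between permutations with the same y. The
rows where y is silent (bottom, top, and that of the first entry) always carry a left point. -/
theorem Compat.exists_same_row (hσ : Compat σ x y q) (hτ : Compat τ x y q) (h0 : σ 0 = τ 0)
    {c : Fin m} (h : IsExternal σ c) :
    ∃ c', τ c' = σ c ∧ IsExternal τ c' ∧ (IsLeft τ c' ↔ IsLeft σ c) := by
  refine ⟨τ.symm (σ c), τ.apply_symm_apply _, ?_⟩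
  set c' := τ.symm (σ c) with hc'
  have e : τ c' = σ c := τ.apply_symm_apply _
  have hext : IsExternal τ c' := by
    by_contra hi
    have e2 := hτ.apply_eq_of_internal hσ hi
    have : c' = c := σ.injective (e2.symm.trans e)
    rw [this] at hi
    exact hi ((hσ.external_iff hτ c).1 h)
  refine ⟨hext, ?_⟩
  by_cases hz : (σ c).val = 0
  · have h1 : IsLeft σ c := Or.inl (isLeftToRightMin_of_eq_zero σ c hz)
    have h2 : IsLeft τ c' := Or.inl (isLeftToRightMin_of_eq_zero τ c' (by rw [e, hz]))
    exact iff_of_true h2 h1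
  by_cases hl : (σ c).val + 1 = m
  · have h1 : IsLeft σ c := Or.inr (isLeftToRightMax_of_eq_last σ c hl)
    have h2 : IsLeft τ c' := Or.inr (isLeftToRightMax_of_eq_last τ c' (by rw [e, hl]))
    exact iff_of_true h2 h1
  by_cases hc : c = 0
  · have : c' = 0 := by
      apply τ.injective; rw [e, hc, h0]
    have h1 : IsLeft σ c := Or.inl (hc ▸ isLeftToRightMin_zero σ)
    have h2 : IsLeft τ c' := Or.inl (this ▸ isLeftToRightMin_zero τ)
    exact iff_of_true h2 h1
  have hc0 : c' ≠ 0 := by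
    rintro h'
    rw [h', ← h0] at e
    exact hc (σ.injective e).symm
  have a1 := hσ.left c h (fun h => hc (Fin.ext (by simpa using h))) hz hl
  have a2 := hτ.left c' hext (fun h => hc0 (Fin.ext (by simpa using h))) (by rwa [e])
    (by rwa [e])
  rw [e] at a2
  exact a2.symm.trans a1

/-- If σ has a left point at c, look at where τ uses the row σ c: it cannot be before c, where the
permutations agree, and after c it would be a left-to-right maximum lying below τ c. If σ has a
right point at c, look at where σ uses the row τ c: after c it would exceed a right-to-left maximum.
-/
theorem Compat.not_lt_of_upper (hσ : Compat σ x y q) (hτ : Compat τ x y q) (h0 : σ 0 = τ 0)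
    {c : Fin m} (ih : ∀ c' < c, σ c' = τ c') (hc : IsExternal σ c) (hUσ : IsUpper σ c)
    (hUτ : IsUpper τ c) : ¬ σ c < τ c := by
  intro hlt
  have hcτ := (hσ.external_iff hτ c).1 hc
  by_cases hLσ : IsLeft σ c
  · obtain ⟨c', e, hext, hL⟩ := hσ.exists_same_row hτ h0 hc
    have hL' := hL.2 hLσ
    have hz := hLσ.isUpper_iff.1 hUσ
    have hmax := hL'.isLeftToRightMax (by rw [e, ← h0]; exact hz)
    rcases lt_trichotomy c' c with hcc | rfl | hcc
    · exact hcc.ne (σ.injective ((ih c' hcc).trans e))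
    · exact hlt.ne e.symm
    · exact absurd (hmax c hcc) (not_lt.2 (by rw [e]; exact hlt.le))
  · have hmax := hc.isRightToLeftMax hUσ hLσ
    obtain ⟨c', e, hext, hL⟩ := hτ.exists_same_row hσ h0.symm hcτ
    rcases lt_trichotomy c' c with hcc | rfl | hcc
    · exact hcc.ne (τ.injective ((ih c' hcc).symm.trans e))
    · exact hlt.ne e
    · exact absurd (hmax c' hcc) (not_lt.2 (by rw [e]; exact hlt.le))

theorem Compat.not_lt_of_not_upper (hσ : Compat σ x y q) (hτ : Compat τ x y q)
    (h0 : σ 0 = τ 0) {c : Fin m} (ih : ∀ c' < c, σ c' = τ c') (hc : IsExternal σ c)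
    (hUσ : ¬ IsUpper σ c) (hUτ : ¬ IsUpper τ c) : ¬ τ c < σ c := by
  intro hlt
  have hcτ := (hσ.external_iff hτ c).1 hc
  by_cases hLσ : IsLeft σ c
  · obtain ⟨c', e, hext, hL⟩ := hσ.exists_same_row hτ h0 hc
    have hL' := hL.2 hLσ
    have hz := (not_iff_not.2 hLσ.isUpper_iff).1 hUσ
    have hmin := hL'.isLeftToRightMin (by rw [e, ← h0]; exact not_lt.1 hz)
    rcases lt_trichotomy c' c with hcc | rfl | hcc
    · exact hcc.ne (σ.injective ((ih c' hcc).trans e))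
    · exact hlt.ne e
    · exact absurd (hmin c hcc) (not_lt.2 (by rw [e]; exact hlt.le))
  · have hmin := isRightToLeftMin_of_not hUσ hLσ
    obtain ⟨c', e, hext, hL⟩ := hτ.exists_same_row hσ h0.symm hcτ
    rcases lt_trichotomy c' c with hcc | rfl | hcc
    · exact hcc.ne (τ.injective ((ih c' hcc).symm.trans e))
    · exact hlt.ne e.symm
    · exact absurd (hmin c' hcc) (not_lt.2 (by rw [e]; exact hlt.le))

/-- Strong induction from left to right: at an external column the common upper bit makes either
strict inequality between the two values impossible. -/
theorem Compat.unique (hσ : Compat σ x y q) (hτ : Compat τ x y q) (h0 : σ 0 = τ 0) :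
    σ = τ := by
  have main : ∀ (N : ℕ) (c : Fin m), c.val = N → c.val + 1 ≠ m → σ c = τ c := by
    intro N
    induction N using Nat.strong_induction_on with
    | _ N ih =>
      intro c hcN hlast
      have ih' : ∀ c' < c, σ c' = τ c' := fun c' hc' =>
        ih c'.val (by rw [← hcN]; exact hc') c' rfl (by have := c.isLt; rw [Fin.lt_def] at hc'; omega)
      by_cases hc0 : c = 0
      · rw [hc0, h0]
      by_cases hint : IsInternal σ c
      · exact hσ.apply_eq_of_internal hτ hint
      have hext : IsExternal σ c := not_not.1 hint
      have hextτ := (hσ.external_iff hτ c).1 hext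
      have hc0' : c.val ≠ 0 := fun h => hc0 (Fin.ext (by simpa using h))
      have hU : IsUpper σ c ↔ IsUpper τ c :=
        (hσ.upper c hext hc0' hlast).symm.trans (hτ.upper c hextτ hc0' hlast)
      have ih'' : ∀ c' < c, τ c' = σ c' := fun c' hc' => (ih' c' hc').symm
      by_cases hUσ : IsUpper σ c
      · exact le_antisymm (not_lt.1 (hτ.not_lt_of_upper hσ h0.symm ih'' hextτ (hU.1 hUσ) hUσ))
          (not_lt.1 (hσ.not_lt_of_upper hτ h0 ih' hext hUσ (hU.1 hUσ)))
      · have hUτ := fun h => hUσ (hU.2 h)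
        exact le_antisymm (not_lt.1 (hσ.not_lt_of_not_upper hτ h0 ih' hext hUσ hUτ))
          (not_lt.1 (hτ.not_lt_of_not_upper hσ h0.symm ih'' hextτ hUτ hUσ))
  ext c
  -- The last column has no recorded bit; its value is the one left over by bijectivity.
  by_cases hlast : c.val + 1 = m
  · obtain ⟨c', hc'⟩ := τ.surjective (σ c)
    by_cases hc'l : c'.val + 1 = m
    · have : c' = c := Fin.ext (by omega)
      rw [← hc', this]
    · have h1 := main _ c' rfl hc'l
      have : c' = c := σ.injective (h1.trans hc')
      rw [this] at hc'l
      exact absurd hlast hc'l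
  · rw [main _ c rfl hlast]

end Unique

/-! ### The number of encodings of one permutation. -/

section Counting
variable {m k : ℕ} [NeZero m] (σ : Equiv.Perm (Fin m))

open scoped Classical in
/-- The columns of the internal points. -/
noncomputable def internalCols (σ : Equiv.Perm (Fin m)) : Finset (Fin m) :=
  Finset.univ.filter fun c => IsInternal σ c

/-- The last index. -/
def lastIdx (m : ℕ) [NeZero m] : Fin m := ⟨m - 1, Nat.sub_lt (NeZero.pos m) one_pos⟩

/-- The columns at which the word of upper columns is not determined. -/
noncomputable def freeCols (σ : Equiv.Perm (Fin m)) : Finset (Fin m) :=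
  insert 0 (insert (lastIdx m) (internalCols σ))

/-- The rows at which the word of left rows is not determined. -/
noncomputable def freeRows (σ : Equiv.Perm (Fin m)) : Finset (Fin m) :=
  insert (σ 0) (insert 0 (insert (lastIdx m) ((internalCols σ).map σ.toEmbedding)))

omit [NeZero m] in
theorem mem_internalCols (c : Fin m) : c ∈ internalCols σ ↔ IsInternal σ c := by
  simp [internalCols]

theorem eq_lastIdx_iff (c : Fin m) : c = lastIdx m ↔ c.val + 1 = m := by
  have := c.isLt
  rw [Fin.ext_iff, lastIdx]
  dsimp only
  omega

theorem eq_zero_iff_val (c : Fin m) : c = 0 ↔ c.val = 0 := by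
  rw [Fin.ext_iff]; simp

theorem notMem_freeCols (c : Fin m) :
    c ∉ freeCols σ ↔ IsExternal σ c ∧ c.val ≠ 0 ∧ c.val + 1 ≠ m := by
  simp only [freeCols, Finset.mem_insert, mem_internalCols, eq_lastIdx_iff, eq_zero_iff_val,
    IsInternal, not_or, not_not, ne_eq]
  exact ⟨fun h => ⟨h.2.2, h.1, h.2.1⟩, fun h => ⟨h.2.1, h.2.2, h.1⟩⟩

theorem apply_notMem_freeRows (c : Fin m) :
    σ c ∉ freeRows σ ↔ IsExternal σ c ∧ c.val ≠ 0 ∧ (σ c).val ≠ 0 ∧ (σ c).val + 1 ≠ m := by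
  simp only [freeRows, Finset.mem_insert, eq_lastIdx_iff, Finset.mem_map, mem_internalCols,
    Equiv.coe_toEmbedding, EmbeddingLike.apply_eq_iff_eq, exists_eq_right, IsInternal,
    eq_zero_iff_val (σ c), eq_zero_iff_val c, not_or, not_not, ne_eq]
  exact ⟨fun h => ⟨h.2.2.2, h.1, h.2.1, h.2.2.1⟩, fun h => ⟨h.2.1, h.2.2.1, h.2.2.2, h.1⟩⟩

omit [NeZero m] in
theorem isExternal_of_leftToRightMin {σ : Equiv.Perm (Fin m)} {c : Fin m}
    (h : IsLeftToRightMin σ c) : IsExternal σ c := Or.inr (Or.inl h)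

theorem card_freeCols (hm : 2 ≤ m) (hk : (internalCols σ).card = k) :
    (freeCols σ).card = k + 2 := by
  have h1 : lastIdx m ∉ internalCols σ := by
    rw [mem_internalCols]
    exact fun h => h (isExternal_last σ _ ((eq_lastIdx_iff _).1 rfl))
  have h2 : (0 : Fin m) ∉ insert (lastIdx m) (internalCols σ) := by
    rw [Finset.mem_insert, mem_internalCols, eq_lastIdx_iff]
    rintro (h | h)
    · simp at h; omega
    · exact h (isExternal_of_leftToRightMin (isLeftToRightMin_zero σ))
  rw [freeCols, Finset.card_insert_of_notMem h2, Finset.card_insert_of_notMem h1, hk]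

theorem card_insert_insert_map (hm : 2 ≤ m) (hk : (internalCols σ).card = k) :
    (insert 0 (insert (lastIdx m) ((internalCols σ).map σ.toEmbedding))).card = k + 2 := by
  have h1 : lastIdx m ∉ (internalCols σ).map σ.toEmbedding := by
    rw [Finset.mem_map]
    rintro ⟨c, hc, e⟩
    rw [mem_internalCols] at hc
    exact hc (Or.inl (isLeftToRightMax_of_eq_last σ c ((eq_lastIdx_iff _).1 e)))
  have h2 : (0 : Fin m) ∉ insert (lastIdx m) ((internalCols σ).map σ.toEmbedding) := by
    rw [Finset.mem_insert, eq_lastIdx_iff, Finset.mem_map]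
    rintro (h | ⟨c, hc, e⟩)
    · simp at h; omega
    · rw [mem_internalCols] at hc
      exact hc (Or.inr (Or.inl (isLeftToRightMin_of_eq_zero σ c ((eq_zero_iff_val _).1 e))))
  rw [Finset.card_insert_of_notMem h2, Finset.card_insert_of_notMem h1, Finset.card_map, hk]

theorem le_card_freeRows (hm : 2 ≤ m) (hk : (internalCols σ).card = k) :
    k + 2 ≤ (freeRows σ).card := by
  rw [← card_insert_insert_map σ hm hk]
  exact Finset.card_le_card (Finset.subset_insert _ _)

theorem card_freeRows_le (hm : 2 ≤ m) (hk : (internalCols σ).card = k) :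
    (freeRows σ).card ≤ k + 3 := by
  refine (Finset.card_insert_le _ _).trans ?_
  rw [card_insert_insert_map σ hm hk]

/-- The row of the first entry is a third boundary row; it is not an internal row because column 0
is external. If the start is extreme it coincides with another boundary row, and one free bit is
lost. -/
theorem card_freeRows (hm : 2 ≤ m) (hk : (internalCols σ).card = k) (h0 : (σ 0).val ≠ 0)
    (h1 : (σ 0).val + 1 ≠ m) : (freeRows σ).card = k + 3 := by
  rw [freeRows, Finset.card_insert_of_notMem, card_insert_insert_map σ hm hk]
  simp only [Finset.mem_insert, eq_zero_iff_val (σ 0), h0, eq_lastIdx_iff, h1, false_or,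
    Finset.mem_map, mem_internalCols, Equiv.coe_toEmbedding, EmbeddingLike.apply_eq_iff_eq,
    exists_eq_right]
  exact fun h => h (isExternal_of_leftToRightMin (isLeftToRightMin_zero σ))

omit [NeZero m] in
theorem card_filter_eq_off (E : Finset (Fin m)) (l : Fin m → Bool) :
    (Finset.univ.filter fun x : Fin m → Bool => ∀ c ∉ E, x c = l c).card = 2 ^ E.card := by
  have : (Finset.univ.filter fun x : Fin m → Bool => ∀ c ∉ E, x c = l c) =
      Fintype.piFinset fun c => if c ∈ E then Finset.univ else {l c} := by
    ext x
    simp only [Finset.mem_filter, Finset.mem_univ, true_and, Fintype.mem_piFinset]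
    refine forall_congr' fun c => ?_
    by_cases h : c ∈ E <;> simp [h]
  rw [this, Fintype.card_piFinset]
  rw [← Finset.prod_subset (Finset.subset_univ E)]
  · rw [Finset.prod_congr rfl (g := fun _ => 2), Finset.prod_const]
    intro c hc
    simp [hc]
  · intro c _ hc
    simp [hc]

/-- The enumerations of the internal points of `σ`. -/
def IsInternalEnum (σ : Equiv.Perm (Fin m)) (q : Fin k → Fin m × Fin m) : Prop :=
  (Function.Injective fun i => (q i).1) ∧ (∀ c, IsInternal σ c ↔ ∃ i, (q i).1 = c) ∧
    ∀ i, (q i).2 = σ (q i).1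

/-- Enumerations of the internal points are bijections with the internal columns. -/
noncomputable def internalEnumEquiv (k : ℕ) :
    {q : Fin k → Fin m × Fin m // IsInternalEnum σ q} ≃ (Fin k ≃ {c // IsInternal σ c}) where
  toFun q := Equiv.ofBijective (fun i => ⟨(q.1 i).1, (q.2.2.1 _).2 ⟨i, rfl⟩⟩) <| by
    refine ⟨fun i j h => q.2.1 (congrArg Subtype.val h), fun c => ?_⟩
    obtain ⟨i, hi⟩ := (q.2.2.1 c.1).1 c.2
    exact ⟨i, Subtype.ext hi⟩
  invFun e := ⟨fun i => ((e i).1, σ (e i).1), fun i j h => e.injective (Subtype.ext h),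
    fun c => ⟨fun h => ⟨e.symm ⟨c, h⟩, by simp⟩, by rintro ⟨i, rfl⟩; exact (e i).2⟩,
    fun i => rfl⟩
  left_inv q := by
    ext i
    · rfl
    · exact congrArg Fin.val (q.2.2.2 i).symm
  right_inv e := by ext i; rfl

open scoped Classical in
omit [NeZero m] in
theorem card_internalEnum (hk : (internalCols σ).card = k) :
    (Finset.univ.filter fun q : Fin k → Fin m × Fin m => IsInternalEnum σ q).card =
      k.factorial := by
  rw [← Fintype.card_subtype, Fintype.card_congr (internalEnumEquiv σ k)]
  have : Fintype.card {c // IsInternal σ c} = k := by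
    rw [Fintype.card_subtype, ← hk, internalCols]
  rw [Fintype.card_equiv (Fintype.equivOfCardEq (by rw [this, Fintype.card_fin])),
    Fintype.card_fin]

-- Compatibility constrains x, y and q separately: the words are prescribed off the free columns and
-- rows, and q is any ordering of the internal points.
open scoped Classical in
theorem card_compat (hm : 2 ≤ m) (hk : (internalCols σ).card = k) :
    (Finset.univ.filter fun t : (Fin m → Bool) × (Fin m → Bool) × (Fin k → Fin m × Fin m) =>
      Compat σ t.1 t.2.1 t.2.2).card = 2 ^ (k + 2) * (2 ^ (freeRows σ).card * k.factorial) := by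
  have : (Finset.univ.filter fun t : (Fin m → Bool) × (Fin m → Bool) ×
      (Fin k → Fin m × Fin m) => Compat σ t.1 t.2.1 t.2.2) =
      (Finset.univ.filter fun x : Fin m → Bool =>
        ∀ c ∉ freeCols σ, x c = decide (IsUpper σ c)) ×ˢ
      ((Finset.univ.filter fun y : Fin m → Bool =>
        ∀ r ∉ freeRows σ, y r = decide (IsLeft σ (σ.symm r))) ×ˢ
      (Finset.univ.filter fun q : Fin k → Fin m × Fin m => IsInternalEnum σ q)) := by
    ext ⟨x, y, q⟩
    simp only [Finset.mem_filter, Finset.mem_univ, true_and, Finset.mem_product]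
    constructor
    · intro h
      refine ⟨fun c hc => ?_, fun r hr => ?_, h.inj, h.internal, h.snd_eq⟩
      · rw [notMem_freeCols] at hc
        rw [Bool.eq_iff_iff, decide_eq_true_iff]
        exact h.upper c hc.1 hc.2.1 hc.2.2
      · obtain ⟨c, rfl⟩ := σ.surjective r
        rw [apply_notMem_freeRows] at hr
        rw [Bool.eq_iff_iff, decide_eq_true_iff, Equiv.symm_apply_apply]
        exact h.left c hr.1 hr.2.1 hr.2.2.1 hr.2.2.2
    · rintro ⟨hx, hy, h1, h2, h3⟩
      refine ⟨h1, h2, h3, fun c a b d => ?_, fun c a b d e => ?_⟩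
      · rw [hx c ((notMem_freeCols σ c).2 ⟨a, b, d⟩), decide_eq_true_iff]
      · rw [hy _ ((apply_notMem_freeRows σ c).2 ⟨a, b, d, e⟩), decide_eq_true_iff,
          Equiv.symm_apply_apply]
  rw [this, Finset.card_product, Finset.card_product, card_internalEnum σ hk]
  congr 1
  · rw [card_filter_eq_off, card_freeCols σ hm hk]
  · rw [card_filter_eq_off]

end Counting

/-! ### All points lie in the enlarged rectangle; double counting of encodings. -/

section Inequalities
variable {m k : ℕ} [NeZero m] (σ : Equiv.Perm (Fin m))

open scoped Classical in
/-- The columns of the upper external points. -/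
noncomputable def upperCols (σ : Equiv.Perm (Fin m)) : Finset (Fin m) :=
  Finset.univ.filter fun c => IsExternal σ c ∧ IsUpper σ c

open scoped Classical in
/-- The columns of the lower external points. -/
noncomputable def lowerCols (σ : Equiv.Perm (Fin m)) : Finset (Fin m) :=
  Finset.univ.filter fun c => IsExternal σ c ∧ ¬ IsUpper σ c

open scoped Classical in
/-- The rows of the left external points. -/
noncomputable def leftRows (σ : Equiv.Perm (Fin m)) : Finset (Fin m) :=
  Finset.univ.filter fun r => IsExternal σ (σ.symm r) ∧ IsLeft σ (σ.symm r)

open scoped Classical in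
/-- The rows of the right external points. -/
noncomputable def rightRows (σ : Equiv.Perm (Fin m)) : Finset (Fin m) :=
  Finset.univ.filter fun r => IsExternal σ (σ.symm r) ∧ ¬ IsLeft σ (σ.symm r)

/-- A left row above the first entry and at most σ c carries a left-to-right maximum, which must
occur no later than c and is upper. With balanced counts this is the side "row at most column + z".
-/
theorem cnt_leftRows_le (c : Fin m) :
    cnt (leftRows σ) ((σ c).val + 1) ≤ cnt (leftRows σ) ((σ 0).val + 1) +
      cnt (upperCols σ) (c.val + 1) := by
  unfold cnt
  rw [← Finset.card_map σ.toEmbedding (s := (upperCols σ).filter _)]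
  refine (Finset.card_le_card ?_).trans (Finset.card_union_le _ _)
  intro r hr
  obtain ⟨c', rfl⟩ := σ.surjective r
  simp only [leftRows, upperCols, Finset.mem_filter, Finset.mem_univ, true_and,
    Equiv.symm_apply_apply, Finset.mem_union, Finset.mem_map, Equiv.coe_toEmbedding,
    EmbeddingLike.apply_eq_iff_eq, exists_eq_right] at hr ⊢
  by_cases h : (σ c').val < (σ 0).val + 1
  · exact Or.inl ⟨hr.1, h⟩
  · have hz : σ 0 < σ c' := by rw [Fin.lt_def]; omega
    refine Or.inr ⟨⟨hr.1.1, hr.1.2.isUpper_iff.2 hz⟩, ?_⟩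
    by_contra hc
    have := hr.1.2.isLeftToRightMax hz c (by rw [Fin.lt_def]; omega)
    rw [Fin.lt_def] at this
    omega

/-- Symmetrically, left rows from σ c up to the first entry carry left-to-right minima occurring no
later than c. This is the side "row + column at least z". -/
theorem cnt_leftRows_zero_le (c : Fin m) :
    cnt (leftRows σ) ((σ 0).val + 1) ≤ cnt (leftRows σ) (σ c).val +
      cnt (lowerCols σ) (c.val + 1) := by
  unfold cnt
  rw [← Finset.card_map σ.toEmbedding (s := (lowerCols σ).filter _)]
  refine (Finset.card_le_card ?_).trans (Finset.card_union_le _ _)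
  intro r hr
  obtain ⟨c', rfl⟩ := σ.surjective r
  simp only [leftRows, lowerCols, Finset.mem_filter, Finset.mem_univ, true_and,
    Equiv.symm_apply_apply, Finset.mem_union, Finset.mem_map, Equiv.coe_toEmbedding,
    EmbeddingLike.apply_eq_iff_eq, exists_eq_right] at hr ⊢
  by_cases h : (σ c').val < (σ c).val
  · exact Or.inl ⟨hr.1, h⟩
  · have hz : σ c' ≤ σ 0 := by rw [Fin.le_def]; omega
    refine Or.inr ⟨⟨hr.1.1, fun hU => ?_⟩, ?_⟩
    · exact absurd (hr.1.2.isUpper_iff.1 hU) (not_lt.2 hz)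
    by_contra hc
    have := hr.1.2.isLeftToRightMin hz c (by rw [Fin.lt_def]; omega)
    rw [Fin.lt_def] at this
    omega

/-- An upper point before c uses either a left row above the first entry or, being a right-to-left
maximum, a right row above σ c. This is the side "row + column + z at most 2m". -/
theorem cnt_upperCols_add_le (c : Fin m) :
    cnt (upperCols σ) c.val + cnt (leftRows σ) ((σ 0).val + 1) +
      cnt (rightRows σ) ((σ c).val + 1) ≤ cnt (leftRows σ) m + cnt (rightRows σ) m := by
  have h : ((upperCols σ).filter fun j => j.val < c.val).map σ.toEmbedding ⊆
      ((leftRows σ).filter fun r => r.val < m) \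
        ((leftRows σ).filter fun r => r.val < (σ 0).val + 1) ∪
      ((rightRows σ).filter fun r => r.val < m) \
        ((rightRows σ).filter fun r => r.val < (σ c).val + 1) := by
    intro r hr
    obtain ⟨c', rfl⟩ := σ.surjective r
    simp only [leftRows, upperCols, rightRows, Finset.mem_filter, Finset.mem_univ, true_and,
      Equiv.symm_apply_apply, Finset.mem_union, Finset.mem_map, Equiv.coe_toEmbedding,
      EmbeddingLike.apply_eq_iff_eq, exists_eq_right, Finset.mem_sdiff, Fin.is_lt, and_true,
      not_and, not_lt] at hr ⊢
    obtain ⟨⟨h1, h2⟩, h3⟩ := hr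
    by_cases hL : IsLeft σ c'
    · have := hL.isUpper_iff.1 h2
      rw [Fin.lt_def] at this
      exact Or.inl ⟨⟨h1, hL⟩, fun _ => by omega⟩
    · have := h1.isRightToLeftMax h2 hL c h3
      rw [Fin.lt_def] at this
      exact Or.inr ⟨⟨h1, hL⟩, fun _ => by omega⟩
  have h1 := (Finset.card_le_card h).trans (Finset.card_union_le _ _)
  rw [Finset.card_map] at h1
  have mono : ∀ (A : Finset (Fin m)) (j : ℕ), j ≤ m →
      ((A.filter fun r => r.val < m) \ (A.filter fun r => r.val < j)).card + cnt A j =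
        cnt A m := by
    intro A j hj
    rw [cnt, cnt, Finset.card_sdiff_add_card_eq_card]
    intro r hr
    simp only [Finset.mem_filter] at hr ⊢
    exact ⟨hr.1, r.isLt⟩
  have m1 := mono (leftRows σ) ((σ 0).val + 1) (by omega)
  have m2 := mono (rightRows σ) ((σ c).val + 1) (by omega)
  unfold cnt at *
  omega

/-- A lower point before c uses either a left row up to the first entry or, being a right-to-left
minimum, a right row below σ c. This is the side "column at most row + z". -/
theorem cnt_lowerCols_le (c : Fin m) :
    cnt (lowerCols σ) c.val ≤ cnt (leftRows σ) ((σ 0).val + 1) + cnt (rightRows σ) (σ c).val := by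
  unfold cnt
  rw [← Finset.card_map σ.toEmbedding (s := (lowerCols σ).filter _)]
  refine (Finset.card_le_card ?_).trans (Finset.card_union_le _ _)
  intro r hr
  obtain ⟨c', rfl⟩ := σ.surjective r
  simp only [leftRows, lowerCols, rightRows, Finset.mem_filter, Finset.mem_univ, true_and,
    Equiv.symm_apply_apply, Finset.mem_union, Finset.mem_map, Equiv.coe_toEmbedding,
    EmbeddingLike.apply_eq_iff_eq, exists_eq_right] at hr ⊢
  obtain ⟨⟨h1, h2⟩, h3⟩ := hr
  by_cases hL : IsLeft σ c'
  · have := (not_iff_not.2 hL.isUpper_iff).1 h2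
    rw [Fin.lt_def] at this
    exact Or.inl ⟨⟨h1, hL⟩, by omega⟩
  · have := isRightToLeftMin_of_not h2 hL c h3
    rw [Fin.lt_def] at this
    exact Or.inr ⟨⟨h1, hL⟩, by omega⟩

theorem mem_fat_of_balanced {s : ℕ} (hU : Balanced (upperCols σ) s)
    (hD : Balanced (lowerCols σ) s) (hL : Balanced (leftRows σ) s)
    (hR : Balanced (rightRows σ) s) (c : Fin m) :
    (c, σ c) ∈ fat m (σ 0).val (5 * s + 5) := by
  have h1 := cnt_leftRows_le σ c
  have h2 := cnt_leftRows_zero_le σ c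
  have h3 := cnt_upperCols_add_le σ c
  have h4 := cnt_lowerCols_le σ c
  have hc := c.isLt
  have hr := (σ c).isLt
  have hz := (σ 0).isLt
  have l1 := hL ((σ c).val + 1) (by omega)
  have l2 := hL ((σ 0).val + 1) (by omega)
  have l3 := hL (σ c).val (by omega)
  have l4 := hL m le_rfl
  have r1 := hR ((σ c).val + 1) (by omega)
  have r3 := hR (σ c).val (by omega)
  have r4 := hR m le_rfl
  have u1 := hU c.val (by omega)
  have u2 := hU (c.val + 1) (by omega)
  have d1 := hD c.val (by omega)
  have d2 := hD (c.val + 1) (by omega)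
  simp only [fat, Finset.mem_filter, Finset.mem_univ, true_and]
  omega

theorem Compat.mem_fat {x y : Fin m → Bool} {q : Fin k → Fin m × Fin m} {σ : Equiv.Perm (Fin m)}
    (h : Compat σ x y q) (hm : 2 ≤ m) (hk : (internalCols σ).card = k) (i : Fin k) :
    q i ∈ fat m (σ 0).val (5 * (dev x + dev y + 2 * (k + 3)) + 5) := by
  have e : q i = ((q i).1, σ (q i).1) := Prod.ext rfl (h.snd_eq i)
  rw [e]
  have mono : ∀ {A : Finset (Fin m)} {s t : ℕ}, Balanced A s → s ≤ t → Balanced A t := by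
    intro A s t hA hst j hj
    have := hA j hj
    omega
  have c1 := (card_freeCols σ hm hk).le
  have c2 := card_freeRows_le σ hm hk
  apply mem_fat_of_balanced
  · refine mono (balanced_of_label x true _ _ c1 ?_) (by omega)
    intro c hc
    rw [notMem_freeCols] at hc
    rw [h.upper c hc.1 hc.2.1 hc.2.2]
    simp [upperCols, hc.1]
  · refine mono (balanced_of_label x false _ _ c1 ?_) (by omega)
    intro c hc
    rw [notMem_freeCols] at hc
    rw [← Bool.not_eq_true, h.upper c hc.1 hc.2.1 hc.2.2]
    simp [lowerCols, hc.1]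
  · refine mono (balanced_of_label y true _ _ c2 ?_) (by omega)
    intro r hr
    obtain ⟨c, rfl⟩ := σ.surjective r
    rw [apply_notMem_freeRows] at hr
    rw [h.left c hr.1 hr.2.1 hr.2.2.1 hr.2.2.2]
    simp [leftRows, hr.1]
  · refine mono (balanced_of_label y false _ _ c2 ?_) (by omega)
    intro r hr
    obtain ⟨c, rfl⟩ := σ.surjective r
    rw [apply_notMem_freeRows] at hr
    rw [← Bool.not_eq_true, h.left c hr.1 hr.2.1 hr.2.2.1 hr.2.2.2]
    simp [rightRows, hr.1]

open scoped Classical in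
/-- The permutations with `k` internal points whose leftmost entry is `z`. -/
noncomputable def startingAt (k : ℕ) (z : Fin m) : Finset (Equiv.Perm (Fin m)) :=
  Finset.univ.filter fun σ => (internalCols σ).card = k ∧ σ 0 = z

/-- For fixed z, forgetting σ from a compatible quadruple is injective by `Compat.unique`. The
parameter f allows for starts with one free row fewer. -/
theorem card_startingAt_le (hm : 2 ≤ m) (k f : ℕ) (z : Fin m)
    (hf : ∀ σ ∈ startingAt k z, f ≤ (freeRows σ).card) :
    (startingAt k z).card * (2 ^ (k + 2) * (2 ^ f * k.factorial)) ≤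
      ∑ x : Fin m → Bool, ∑ y : Fin m → Bool,
        (fat m z.val (5 * (dev x + dev y + 2 * (k + 3)) + 5)).card ^ k := by
  classical
  set S := (startingAt k z).sigma fun σ => (Finset.univ.filter fun t : (Fin m → Bool) ×
    (Fin m → Bool) × (Fin k → Fin m × Fin m) => Compat σ t.1 t.2.1 t.2.2) with hS
  set T := (Finset.univ : Finset ((Fin m → Bool) × (Fin m → Bool))).sigma fun xy =>
    Fintype.piFinset fun _ : Fin k =>
      fat m z.val (5 * (dev xy.1 + dev xy.2 + 2 * (k + 3)) + 5) with hT
  have h1 : (startingAt k z).card * (2 ^ (k + 2) * (2 ^ f * k.factorial)) ≤ S.card := by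
    rw [hS, Finset.card_sigma, ← smul_eq_mul, ← Finset.sum_const]
    apply Finset.sum_le_sum
    intro σ hσ
    have hσ' := hσ
    simp only [startingAt, Finset.mem_filter] at hσ'
    rw [card_compat σ hm hσ'.2.1]
    gcongr
    · norm_num
    · exact hf σ hσ
  have h2 : T.card = ∑ x : Fin m → Bool, ∑ y : Fin m → Bool,
        (fat m z.val (5 * (dev x + dev y + 2 * (k + 3)) + 5)).card ^ k := by
    rw [hT, Finset.card_sigma, ← Finset.univ_product_univ, Finset.sum_product]
    simp [Fintype.card_piFinset]
  rw [← h2]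
  refine h1.trans ?_
  apply Finset.card_le_card_of_injOn (fun st => ⟨(st.2.1, st.2.2.1), st.2.2.2⟩)
  · rintro ⟨σ, x, y, q⟩ h
    simp only [hS, Finset.coe_sigma, Set.mem_sigma_iff, Finset.mem_coe, startingAt,
      Finset.mem_filter, Finset.mem_univ, true_and] at h
    simp only [hT, Finset.coe_sigma, Set.mem_sigma_iff, Finset.mem_coe, Finset.mem_univ, true_and,
      Fintype.mem_piFinset]
    intro i
    have := h.2.mem_fat hm h.1.1 i
    rwa [h.1.2] at this
  · rintro ⟨σ, x, y, q⟩ h ⟨σ', x', y', q'⟩ h' e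
    simp only [hS, Finset.coe_sigma, Set.mem_sigma_iff, Finset.mem_coe, startingAt,
      Finset.mem_filter, Finset.mem_univ, true_and] at h h'
    simp only [Sigma.mk.injEq, Prod.mk.injEq, heq_eq_eq] at e
    obtain ⟨⟨rfl, rfl⟩, rfl⟩ := e
    obtain rfl := h.2.unique h'.2 (h.1.2.trans h'.1.2.symm)
    rfl

/-- The converse count: G is a family of lists that are realised by some σ, and each σ absorbs at
most its number of encodings. -/
theorem card_le_startingAt (hm : 2 ≤ m) (k : ℕ) (z : Fin m)
    (G : (Fin m → Bool) → (Fin m → Bool) → Finset (Fin k → Fin m × Fin m))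
    (hG : ∀ x y, ∀ q ∈ G x y, ∃ σ ∈ startingAt k z, Compat σ x y q) :
    ∑ x : Fin m → Bool, ∑ y : Fin m → Bool, (G x y).card ≤
      (startingAt k z).card * (2 ^ (k + 2) * (2 ^ (k + 3) * k.factorial)) := by
  classical
  set S := (startingAt k z).sigma fun σ => (Finset.univ.filter fun t : (Fin m → Bool) ×
    (Fin m → Bool) × (Fin k → Fin m × Fin m) => Compat σ t.1 t.2.1 t.2.2) with hS
  set T := (Finset.univ : Finset ((Fin m → Bool) × (Fin m → Bool))).sigma fun xy =>
    G xy.1 xy.2 with hT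
  have h1 : S.card ≤ (startingAt k z).card * (2 ^ (k + 2) * (2 ^ (k + 3) * k.factorial)) := by
    rw [hS, Finset.card_sigma, ← smul_eq_mul (startingAt k z).card, ← Finset.sum_const]
    apply Finset.sum_le_sum
    intro σ hσ
    simp only [startingAt, Finset.mem_filter] at hσ
    rw [card_compat σ hm hσ.2.1]
    gcongr
    · norm_num
    · exact card_freeRows_le σ hm hσ.2.1
  have h2 : T.card = ∑ x : Fin m → Bool, ∑ y : Fin m → Bool, (G x y).card := by
    rw [hT, Finset.card_sigma, ← Finset.univ_product_univ, Finset.sum_product]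
  rw [← h2]
  refine le_trans ?_ h1
  choose! F hF using hG
  apply Finset.card_le_card_of_injOn
    (fun st => ⟨F st.1.1 st.1.2 st.2, (st.1.1, st.1.2, st.2)⟩)
  · rintro ⟨⟨x, y⟩, q⟩ h
    simp only [hT, Finset.coe_sigma, Set.mem_sigma_iff, Finset.mem_coe, Finset.mem_univ,
      true_and] at h
    simp only [hS, Finset.coe_sigma, Set.mem_sigma_iff, Finset.mem_coe,
      Finset.mem_filter, Finset.mem_univ, true_and]
    exact hF x y q h
  · rintro ⟨⟨x, y⟩, q⟩ _ ⟨⟨x', y'⟩, q'⟩ _ e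
    simp only [Sigma.mk.injEq] at e
    have e2 := eq_of_heq e.2
    simp only [Prod.mk.injEq] at e2
    obtain ⟨rfl, rfl, rfl⟩ := e2
    rfl

end Inequalities
-- Counting functions, and building a permutation from a balanced layout.
section Cnt
variable {m : ℕ} (A : Finset (Fin m))

theorem cnt_mono {i j : ℕ} (h : i ≤ j) : cnt A i ≤ cnt A j := by
  apply Finset.card_le_card
  intro c hc
  simp only [Finset.mem_filter] at hc ⊢
  exact ⟨hc.1, by omega⟩

theorem cnt_eq_card : cnt A m = A.card := by
  unfold cnt
  congr 1
  ext c; simp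

theorem cnt_succ_of_mem {c : Fin m} (h : c ∈ A) : cnt A (c.val + 1) = cnt A c.val + 1 := by
  unfold cnt
  rw [← Finset.card_insert_of_notMem (s := A.filter fun a => a.val < c.val) (a := c) (by simp)]
  congr 1
  ext a
  simp only [Finset.mem_filter, Finset.mem_insert, Fin.ext_iff]
  constructor
  · rintro ⟨h1, h2⟩
    by_cases h3 : a.val = c.val
    · exact Or.inl h3
    · exact Or.inr ⟨h1, by omega⟩
  · rintro (h1 | ⟨h1, h2⟩)
    · exact ⟨by rwa [Fin.ext h1], by omega⟩
    · exact ⟨h1, by omega⟩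

theorem cnt_lt_cnt {c c' : Fin m} (h : c ∈ A) (hc : c < c') : cnt A c.val < cnt A c'.val := by
  have h1 := cnt_succ_of_mem A h
  have h2 := cnt_mono A (show c.val + 1 ≤ c'.val from hc)
  omega

theorem cnt_lt_card {c : Fin m} (h : c ∈ A) : cnt A c.val < A.card := by
  have h1 := cnt_succ_of_mem A h
  have h2 := cnt_mono A (show c.val + 1 ≤ m from c.isLt)
  rw [cnt_eq_card] at h2
  omega

theorem exists_mem_of_cnt_lt {i j : ℕ} (h : cnt A i < cnt A j) :
    ∃ c ∈ A, i ≤ c.val ∧ c.val < j := by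
  by_contra! hcon
  refine absurd h (not_lt.2 (Finset.card_le_card ?_))
  intro c hc
  simp only [Finset.mem_filter] at hc ⊢
  refine ⟨hc.1, ?_⟩
  by_contra hi
  have := hcon c hc.1 (by omega)
  omega

end Cnt

/-- Choosing a key for each column and for each row gives two bijections onto the same m keys;
compose one with the inverse of the other. -/
theorem exists_perm_of_keys {m : ℕ} (A B : Fin m → ℕ → Prop)
    (hA : ∀ c, ∃ n < m, A c n) (hB : ∀ c, ∃ n < m, B c n)
    (uA : ∀ c c' n, A c n → A c' n → c = c') (uB : ∀ c c' n, B c n → B c' n → c = c') :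
    ∃ σ : Equiv.Perm (Fin m), ∀ c, ∃ n, A c n ∧ B (σ c) n := by
  choose f hf hf' using hA
  choose g hg hg' using hB
  have injf : Function.Injective fun c => (⟨f c, hf c⟩ : Fin m) := by
    intro c c' h
    simp only [Fin.mk.injEq] at h
    exact uA c c' (f c) (hf' c) (h ▸ hf' c')
  have injg : Function.Injective fun c => (⟨g c, hg c⟩ : Fin m) := by
    intro c c' h
    simp only [Fin.mk.injEq] at h
    exact uB c c' (g c) (hg' c) (h ▸ hg' c')
  set F := Equiv.ofBijective _ (Finite.injective_iff_bijective.1 injf) with hF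
  set G := Equiv.ofBijective _ (Finite.injective_iff_bijective.1 injg) with hG
  refine ⟨F.trans G.symm, fun c => ⟨f c, hf' c, ?_⟩⟩
  have : G ((F.trans G.symm) c) = F c := by simp
  have h2 : g ((F.trans G.symm) c) = f c := congrArg Fin.val this
  have h3 := hg' ((F.trans G.symm) c)
  rwa [h2] at h3

/-- A partition of the columns into upper, lower and internal ones and of the rows into left,
right and internal ones, with balanced counts and the internal points deep inside the
rectangle. -/
structure Layout (m k : ℕ) [NeZero m] where
  U : Finset (Fin m)
  D : Finset (Fin m)
  L : Finset (Fin m)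
  R : Finset (Fin m)
  q : Fin k → Fin m × Fin m
  z : Fin m
  s : ℕ
  inj_fst : Function.Injective fun i => (q i).1
  inj_snd : Function.Injective fun i => (q i).2
  cover_col : ∀ c, c ∈ U ∨ c ∈ D ∨ ∃ i, (q i).1 = c
  cover_row : ∀ r, r ∈ L ∨ r ∈ R ∨ ∃ i, (q i).2 = r
  disj_col : ∀ c ∈ U, c ∉ D
  disj_row : ∀ r ∈ L, r ∉ R
  fst_notMem_U : ∀ i, (q i).1 ∉ U
  fst_notMem_D : ∀ i, (q i).1 ∉ D
  snd_notMem_L : ∀ i, (q i).2 ∉ L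
  snd_notMem_R : ∀ i, (q i).2 ∉ R
  zero_mem_D : 0 ∈ D
  last_mem_D : lastIdx m ∈ D
  zero_mem_L : 0 ∈ L
  last_mem_L : lastIdx m ∈ L
  z_mem_L : z ∈ L
  balanced_U : Balanced U s
  balanced_D : Balanced D s
  balanced_L : Balanced L s
  balanced_R : Balanced R s
  one_le : 1 ≤ s
  le_z : 20 * s ≤ z.val
  z_le : 20 * s + z.val ≤ m
  thin : ∀ i, q i ∈ AlmostSquare.thin m z.val (20 * s)

namespace Layout
variable {m k : ℕ} [NeZero m] (Λ : Layout m k)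

theorem card_partition {m k : ℕ} (A B : Finset (Fin m)) (p : Fin k → Fin m)
    (hp : Function.Injective p) (cover : ∀ c, c ∈ A ∨ c ∈ B ∨ ∃ i, p i = c)
    (disj : ∀ c ∈ A, c ∉ B) (hA : ∀ i, p i ∉ A) (hB : ∀ i, p i ∉ B) :
    A.card + B.card + k = m := by
  have h1 : A ∪ B ∪ Finset.univ.image p = Finset.univ := by
    ext c
    have := cover c
    simp only [Finset.mem_union, Finset.mem_image, Finset.mem_univ, true_and, iff_true]
    tauto
  have h2 := congrArg Finset.card h1
  rw [Finset.card_union_of_disjoint, Finset.card_union_of_disjoint,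
    Finset.card_image_of_injective _ hp] at h2
  · simpa using h2
  · exact Finset.disjoint_left.2 disj
  · rw [Finset.disjoint_left]
    intro c hc hc'
    simp only [Finset.mem_union, Finset.mem_image, Finset.mem_univ, true_and] at hc hc'
    obtain ⟨i, rfl⟩ := hc'
    rcases hc with h | h
    · exact hA i h
    · exact hB i h

theorem card_cols : Λ.U.card + Λ.D.card + k = m :=
  card_partition _ _ _ Λ.inj_fst Λ.cover_col Λ.disj_col Λ.fst_notMem_U Λ.fst_notMem_D

theorem card_rows : Λ.L.card + Λ.R.card + k = m :=
  card_partition _ _ _ Λ.inj_snd Λ.cover_row Λ.disj_row Λ.snd_notMem_L Λ.snd_notMem_R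

/-- The position of a column in the reading order of the columns. -/
def ColKey (c : Fin m) (n : ℕ) : Prop :=
  (c ∈ Λ.U ∧ n = cnt Λ.U c) ∨ (c ∈ Λ.D ∧ n = Λ.U.card + cnt Λ.D c) ∨
    ∃ i, (Λ.q i).1 = c ∧ n = Λ.U.card + Λ.D.card + i.val

/-- The position of a row in the reading order of the rows. -/
def RowKey (r : Fin m) (n : ℕ) : Prop :=
  (r ∈ Λ.L ∧ Λ.z < r ∧ n + cnt Λ.L (Λ.z.val + 1) = cnt Λ.L r) ∨
  (r ∈ Λ.L ∧ r ≤ Λ.z ∧ n + cnt Λ.L (r.val + 1) = Λ.U.card + cnt Λ.L (Λ.z.val + 1)) ∨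
  (r ∈ Λ.R ∧ n < Λ.U.card ∧
    n + cnt Λ.L (Λ.z.val + 1) + cnt Λ.R (r.val + 1) = Λ.L.card + Λ.R.card) ∨
  (r ∈ Λ.R ∧ Λ.U.card + cnt Λ.L (Λ.z.val + 1) + cnt Λ.R (r.val + 1) ≤ Λ.L.card + Λ.R.card ∧
    n = Λ.U.card + cnt Λ.L (Λ.z.val + 1) + cnt Λ.R r) ∨
    ∃ i, (Λ.q i).2 = r ∧ n = Λ.U.card + Λ.D.card + i.val

/-- Balance and the 20s margins around z make each of the upper and lower column sets larger than
its left chain, so both also receive right rows. -/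
theorem card_bounds : Λ.L.card < Λ.U.card + cnt Λ.L (Λ.z.val + 1) ∧
    cnt Λ.L (Λ.z.val + 1) < Λ.D.card ∧ cnt Λ.L (Λ.z.val + 1) ≤ Λ.L.card := by
  have hz := Λ.z.isLt
  have h1 := Λ.balanced_L (Λ.z.val + 1) (by omega)
  have h2 := Λ.balanced_L m le_rfl
  have h3 := Λ.balanced_U m le_rfl
  have h4 := Λ.balanced_D m le_rfl
  have h5 := cnt_mono Λ.L (show Λ.z.val + 1 ≤ m by omega)
  rw [cnt_eq_card] at h2 h3 h4 h5
  have := Λ.le_z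
  have := Λ.z_le
  have := Λ.one_le
  omega

theorem exists_colKey (c : Fin m) : ∃ n < m, Λ.ColKey c n := by
  have hc := Λ.card_cols
  rcases Λ.cover_col c with h | h | ⟨i, h⟩
  · exact ⟨_, by have := cnt_lt_card _ h; omega, Or.inl ⟨h, rfl⟩⟩
  · exact ⟨_, by have := cnt_lt_card _ h; omega, Or.inr (Or.inl ⟨h, rfl⟩)⟩
  · exact ⟨_, by have := i.isLt; omega, Or.inr (Or.inr ⟨i, h, rfl⟩)⟩

omit [NeZero m] in
theorem eq_of_cnt_eq {A : Finset (Fin m)} {c c' : Fin m} (h : c ∈ A) (h' : c' ∈ A)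
    (e : cnt A c = cnt A c') : c = c' := by
  rcases lt_trichotomy c c' with hc | hc | hc
  · exact absurd e (cnt_lt_cnt A h hc).ne
  · exact hc
  · exact absurd e (cnt_lt_cnt A h' hc).ne'

theorem colKey_unique (c c' : Fin m) (n : ℕ) (h : Λ.ColKey c n) (h' : Λ.ColKey c' n) :
    c = c' := by
  rcases h with ⟨h, e⟩ | ⟨h, e⟩ | ⟨i, h, e⟩ <;> rcases h' with ⟨h', e'⟩ | ⟨h', e'⟩ | ⟨i', h', e'⟩
  · exact eq_of_cnt_eq h h' (by omega)
  · have := cnt_lt_card _ h; omega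
  · have := cnt_lt_card _ h; omega
  · have := cnt_lt_card _ h'; omega
  · exact eq_of_cnt_eq h h' (by omega)
  · have := cnt_lt_card _ h; omega
  · have := cnt_lt_card _ h'; omega
  · have := cnt_lt_card _ h'; omega
  · have : i = i' := Fin.ext (by omega)
    rw [← h, ← h', this]

/-- The row order pairs with upper, lower, then internal columns. Upper: left rows above z
ascending, then right rows descending from the top until the upper columns are used up. Lower: left
rows descending from z, then the remaining right rows ascending. -/
theorem exists_rowKey (r : Fin m) : ∃ n < m, Λ.RowKey r n := by
  have hc := Λ.card_cols
  have hr := Λ.card_rows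
  obtain ⟨b1, b2, b3⟩ := Λ.card_bounds
  rcases Λ.cover_row r with h | h | ⟨i, h⟩
  · have h1 := cnt_lt_card _ h
    rcases lt_or_ge Λ.z r with hz | hz
    · have h2 := cnt_mono Λ.L (show Λ.z.val + 1 ≤ r.val from hz)
      exact ⟨cnt Λ.L r - cnt Λ.L (Λ.z.val + 1), by omega, Or.inl ⟨h, hz, by omega⟩⟩
    · have h2 := cnt_mono Λ.L (show r.val + 1 ≤ Λ.z.val + 1 by rw [Fin.le_def] at hz; omega)
      have h3 := cnt_succ_of_mem _ h
      exact ⟨Λ.U.card + cnt Λ.L (Λ.z.val + 1) - cnt Λ.L (r.val + 1), by omega,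
        Or.inr (Or.inl ⟨h, hz, by omega⟩)⟩
  · have h1 := cnt_lt_card _ h
    have h3 := cnt_succ_of_mem _ h
    by_cases hn : Λ.L.card + Λ.R.card <
        Λ.U.card + cnt Λ.L (Λ.z.val + 1) + cnt Λ.R (r.val + 1)
    · exact ⟨Λ.L.card + Λ.R.card - cnt Λ.L (Λ.z.val + 1) - cnt Λ.R (r.val + 1), by omega,
        Or.inr (Or.inr (Or.inl ⟨h, by omega, by omega⟩))⟩
    · exact ⟨_, by omega, Or.inr (Or.inr (Or.inr (Or.inl ⟨h, by omega, rfl⟩)))⟩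
  · exact ⟨_, by have := i.isLt; omega, Or.inr (Or.inr (Or.inr (Or.inr ⟨i, h, rfl⟩)))⟩

theorem rowKey_unique (r r' : Fin m) (n : ℕ) (h : Λ.RowKey r n) (h' : Λ.RowKey r' n) :
    r = r' := by
  have hc := Λ.card_cols
  have hr := Λ.card_rows
  obtain ⟨b1, b2, b3⟩ := Λ.card_bounds
  rcases h with ⟨h, hz, e⟩ | ⟨h, hz, e⟩ | ⟨h, hn, e⟩ | ⟨h, hn, e⟩ | ⟨i, h, e⟩
  · have g1 := cnt_lt_card _ h
    rcases h' with ⟨h', hz', e'⟩ | ⟨h', hz', e'⟩ | ⟨h', hn', e'⟩ | ⟨h', hn', e'⟩ | ⟨i', h', e'⟩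
    · exact eq_of_cnt_eq h h' (by omega)
    · have := cnt_mono Λ.L (show r'.val + 1 ≤ Λ.z.val + 1 by rw [Fin.le_def] at hz'; omega)
      omega
    · have := cnt_lt_card _ h'
      have := cnt_succ_of_mem _ h'
      omega
    · omega
    · omega
  · have g1 := cnt_succ_of_mem _ h
    have g2 := cnt_mono Λ.L (show r.val + 1 ≤ Λ.z.val + 1 by rw [Fin.le_def] at hz; omega)
    rcases h' with ⟨h', hz', e'⟩ | ⟨h', hz', e'⟩ | ⟨h', hn', e'⟩ | ⟨h', hn', e'⟩ | ⟨i', h', e'⟩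
    · have := cnt_lt_card _ h'
      omega
    · have := cnt_succ_of_mem _ h'
      exact eq_of_cnt_eq h h' (by omega)
    · omega
    · omega
    · omega
  · have g1 := cnt_succ_of_mem _ h
    have g2 := cnt_lt_card _ h
    rcases h' with ⟨h', hz', e'⟩ | ⟨h', hz', e'⟩ | ⟨h', hn', e'⟩ | ⟨h', hn', e'⟩ | ⟨i', h', e'⟩
    · have := cnt_lt_card _ h'
      omega
    · have := cnt_mono Λ.L (show r'.val + 1 ≤ Λ.z.val + 1 by rw [Fin.le_def] at hz'; omega)
      omega
    · have := cnt_succ_of_mem _ h'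
      exact eq_of_cnt_eq h h' (by omega)
    · omega
    · omega
  · have g1 := cnt_succ_of_mem _ h
    have g2 := cnt_lt_card _ h
    rcases h' with ⟨h', hz', e'⟩ | ⟨h', hz', e'⟩ | ⟨h', hn', e'⟩ | ⟨h', hn', e'⟩ | ⟨i', h', e'⟩
    · have := cnt_lt_card _ h'
      omega
    · have := cnt_succ_of_mem _ h'
      omega
    · omega
    · exact eq_of_cnt_eq h h' (by omega)
    · omega
  · rcases h' with ⟨h', hz', e'⟩ | ⟨h', hz', e'⟩ | ⟨h', hn', e'⟩ | ⟨h', hn', e'⟩ | ⟨i', h', e'⟩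
    · have := cnt_lt_card _ h'
      omega
    · have := cnt_succ_of_mem _ h'
      omega
    · omega
    · have := cnt_succ_of_mem _ h'
      omega
    · have : i = i' := Fin.ext (by omega)
      rw [← h, ← h', this]

end Layout
-- The permutation following a layout has the prescribed records and internal points.
namespace Layout
variable {m k : ℕ} [NeZero m] (Λ : Layout m k)

/-- The permutation `σ` follows the four chains prescribed by the layout `Λ`. -/
structure Follows (σ : Equiv.Perm (Fin m)) : Prop where
  upper : ∀ c ∈ Λ.U,
    (σ c ∈ Λ.L ∧ Λ.z < σ c ∧ cnt Λ.U c + cnt Λ.L (Λ.z.val + 1) = cnt Λ.L (σ c)) ∨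
    (σ c ∈ Λ.R ∧ cnt Λ.U c + cnt Λ.L (Λ.z.val + 1) + cnt Λ.R ((σ c).val + 1) =
      Λ.L.card + Λ.R.card)
  lower : ∀ c ∈ Λ.D,
    (σ c ∈ Λ.L ∧ σ c ≤ Λ.z ∧ cnt Λ.D c + cnt Λ.L ((σ c).val + 1) =
      cnt Λ.L (Λ.z.val + 1)) ∨
    (σ c ∈ Λ.R ∧ cnt Λ.D c = cnt Λ.L (Λ.z.val + 1) + cnt Λ.R (σ c))
  internal : ∀ i, σ (Λ.q i).1 = (Λ.q i).2

theorem exists_follows : ∃ σ, Λ.Follows σ := by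
  obtain ⟨σ, hσ⟩ := exists_perm_of_keys Λ.ColKey Λ.RowKey Λ.exists_colKey Λ.exists_rowKey
    Λ.colKey_unique Λ.rowKey_unique
  have hr := Λ.card_rows
  have hcc := Λ.card_cols
  obtain ⟨b1, b2, b3⟩ := Λ.card_bounds
  refine ⟨σ, ⟨fun c hc => ?_, fun c hc => ?_, fun i => ?_⟩⟩
  · obtain ⟨n, hn, hn'⟩ := hσ c
    have hlt := cnt_lt_card _ hc
    have e : n = cnt Λ.U c := by
      rcases hn with ⟨h, e⟩ | ⟨h, e⟩ | ⟨i, h, e⟩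
      · exact e
      · exact absurd h (Λ.disj_col c hc)
      · exact absurd hc (h ▸ Λ.fst_notMem_U i)
    subst e
    rcases hn' with ⟨h, hz, e⟩ | ⟨h, hz, e⟩ | ⟨h, hn, e⟩ | ⟨h, hn, e⟩ | ⟨i, h, e⟩
    · exact Or.inl ⟨h, hz, e⟩
    · have g2 := cnt_mono Λ.L (show (σ c).val + 1 ≤ Λ.z.val + 1 by rw [Fin.le_def] at hz; omega)
      omega
    · exact Or.inr ⟨h, e⟩
    · omega
    · omega
  · obtain ⟨n, hn, hn'⟩ := hσ c
    have hlt := cnt_lt_card _ hc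
    have e : n = Λ.U.card + cnt Λ.D c := by
      rcases hn with ⟨h, e⟩ | ⟨h, e⟩ | ⟨i, h, e⟩
      · exact absurd hc (Λ.disj_col c h)
      · exact e
      · exact absurd hc (h ▸ Λ.fst_notMem_D i)
    subst e
    rcases hn' with ⟨h, hz, e⟩ | ⟨h, hz, e⟩ | ⟨h, hn, e⟩ | ⟨h, hn, e⟩ | ⟨i, h, e⟩
    · have := cnt_lt_card _ h
      omega
    · exact Or.inl ⟨h, hz, by omega⟩
    · omega
    · exact Or.inr ⟨h, by omega⟩
    · omega
  · obtain ⟨n, hn, hn'⟩ := hσ (Λ.q i).1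
    have e : n = Λ.U.card + Λ.D.card + i.val := by
      rcases hn with ⟨h, e⟩ | ⟨h, e⟩ | ⟨j, h, e⟩
      · exact absurd h (Λ.fst_notMem_U i)
      · exact absurd h (Λ.fst_notMem_D i)
      · rw [Λ.inj_fst h] at e
        exact e
    subst e
    rcases hn' with ⟨h, hz, e⟩ | ⟨h, hz, e⟩ | ⟨h, hn, e⟩ | ⟨h, hn, e⟩ | ⟨j, h, e⟩
    · have := cnt_lt_card _ h
      omega
    · have := cnt_succ_of_mem _ h
      omega
    · have := cnt_succ_of_mem _ h
      omega
    · have := cnt_succ_of_mem _ h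
      omega
    · have : i = j := Fin.ext (by omega)
      rw [← h, this]

variable {Λ} {σ : Equiv.Perm (Fin m)}

namespace Follows

/-- Balance turns the counting identity of a chain into its approximate line; this and the next
three lemmas locate the four sides to within at most 5s + 2. -/
theorem upper_left_pos (_ : Λ.Follows σ) {c : Fin m}
    (e : cnt Λ.U c + cnt Λ.L (Λ.z.val + 1) = cnt Λ.L (σ c)) :
    (σ c).val ≤ Λ.z.val + c.val + 3 * Λ.s + 1 ∧
      Λ.z.val + c.val ≤ (σ c).val + 3 * Λ.s + 1 := by
  have h1 := Λ.balanced_U c c.isLt.le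
  have h2 := Λ.balanced_L (Λ.z.val + 1) Λ.z.isLt
  have h3 := Λ.balanced_L (σ c) (σ c).isLt.le
  omega

theorem upper_right_pos (_ : Λ.Follows σ) {c : Fin m}
    (e : cnt Λ.U c + cnt Λ.L (Λ.z.val + 1) + cnt Λ.R ((σ c).val + 1) =
      Λ.L.card + Λ.R.card) :
    (σ c).val + c.val + Λ.z.val ≤ 2 * m + 5 * Λ.s + 2 ∧
      2 * m ≤ (σ c).val + c.val + Λ.z.val + 5 * Λ.s + 2 := by
  have h1 := Λ.balanced_U c c.isLt.le
  have h2 := Λ.balanced_L (Λ.z.val + 1) Λ.z.isLt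
  have h3 := Λ.balanced_R ((σ c).val + 1) (σ c).isLt
  have h4 := Λ.balanced_L m le_rfl
  have h5 := Λ.balanced_R m le_rfl
  rw [cnt_eq_card] at h4 h5
  omega

theorem lower_left_pos (_ : Λ.Follows σ) {c : Fin m}
    (e : cnt Λ.D c + cnt Λ.L ((σ c).val + 1) = cnt Λ.L (Λ.z.val + 1)) :
    (σ c).val + c.val ≤ Λ.z.val + 3 * Λ.s + 1 ∧
      Λ.z.val ≤ (σ c).val + c.val + 3 * Λ.s + 1 := by
  have h1 := Λ.balanced_D c c.isLt.le
  have h2 := Λ.balanced_L (Λ.z.val + 1) Λ.z.isLt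
  have h3 := Λ.balanced_L ((σ c).val + 1) (σ c).isLt
  omega

theorem lower_right_pos (_ : Λ.Follows σ) {c : Fin m}
    (e : cnt Λ.D c = cnt Λ.L (Λ.z.val + 1) + cnt Λ.R (σ c)) :
    (σ c).val + Λ.z.val ≤ c.val + 3 * Λ.s + 1 ∧
      c.val ≤ (σ c).val + Λ.z.val + 3 * Λ.s + 1 := by
  have h1 := Λ.balanced_D c c.isLt.le
  have h2 := Λ.balanced_L (Λ.z.val + 1) Λ.z.isLt
  have h3 := Λ.balanced_R (σ c) (σ c).isLt.le
  omega

theorem thin_ineq (_ : Λ.Follows σ) (i : Fin k) :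
    (Λ.q i).2.val + 20 * Λ.s ≤ (Λ.q i).1.val + Λ.z.val ∧
    (Λ.q i).1.val + 20 * Λ.s ≤ (Λ.q i).2.val + Λ.z.val ∧
    Λ.z.val + 20 * Λ.s ≤ (Λ.q i).1.val + (Λ.q i).2.val ∧
    (Λ.q i).1.val + (Λ.q i).2.val + Λ.z.val + 20 * Λ.s ≤ 2 * m := by
  have := Λ.thin i
  simpa [AlmostSquare.thin] using this

/-- A sufficient condition for a property to hold at every column. -/
theorem forall_cols (h : Λ.Follows σ) {P : Fin m → Prop}
    (hUL : ∀ c ∈ Λ.U, σ c ∈ Λ.L → Λ.z < σ c →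
      cnt Λ.U c + cnt Λ.L (Λ.z.val + 1) = cnt Λ.L (σ c) → P c)
    (hUR : ∀ c ∈ Λ.U, σ c ∈ Λ.R → cnt Λ.U c + cnt Λ.L (Λ.z.val + 1) +
      cnt Λ.R ((σ c).val + 1) = Λ.L.card + Λ.R.card → P c)
    (hDL : ∀ c ∈ Λ.D, σ c ∈ Λ.L → σ c ≤ Λ.z →
      cnt Λ.D c + cnt Λ.L ((σ c).val + 1) = cnt Λ.L (Λ.z.val + 1) → P c)
    (hDR : ∀ c ∈ Λ.D, σ c ∈ Λ.R →
      cnt Λ.D c = cnt Λ.L (Λ.z.val + 1) + cnt Λ.R (σ c) → P c)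
    (hI : ∀ c i, (Λ.q i).1 = c → (Λ.q i).2 = σ c → P c) (c : Fin m) : P c := by
  rcases Λ.cover_col c with hc | hc | ⟨i, rfl⟩
  · rcases h.upper c hc with ⟨h1, h2, h3⟩ | ⟨h1, h2⟩
    · exact hUL c hc h1 h2 h3
    · exact hUR c hc h1 h2
  · rcases h.lower c hc with ⟨h1, h2, h3⟩ | ⟨h1, h2⟩
    · exact hDL c hc h1 h2 h3
    · exact hDR c hc h1 h2
  · exact hI _ i rfl (h.internal i).symm

omit [NeZero m] in
theorem lt_of_cnt_lt {A : Finset (Fin m)} {i j : ℕ} (h : cnt A i < cnt A j) : i < j := by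
  by_contra hc
  exact absurd (cnt_mono A (not_lt.1 hc)) (not_le.2 h)

/-- Points of the same chain compare by counts, and upper right points come later since right rows
are used after left ones. The other points are lower by position: the 20s margins exceed the errors
of the chains. -/
theorem leftToRightMax (h : Λ.Follows σ) {c : Fin m} (hL : σ c ∈ Λ.L)
    (hz : Λ.z < σ c) (e : cnt Λ.U c + cnt Λ.L (Λ.z.val + 1) = cnt Λ.L (σ c)) :
    IsLeftToRightMax σ c := by
  have p := h.upper_left_pos e
  have := Λ.le_z
  have := Λ.z_le
  have := Λ.one_le
  have hcc := cnt_lt_card _ hL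
  refine h.forall_cols ?_ ?_ ?_ ?_ ?_
  · intro c' hc' _ _ e' hlt
    have := cnt_lt_cnt _ hc' hlt
    exact lt_of_cnt_lt (A := Λ.L) (by omega)
  · intro c' hc' hR e' hlt
    have := cnt_lt_cnt _ hc' hlt
    have := cnt_lt_card _ hR
    have := cnt_succ_of_mem _ hR
    omega
  · intro c' hc' _ hz' _ _
    exact hz'.trans_lt hz
  · intro c' hc' _ e' hlt
    have := h.lower_right_pos e'
    rw [Fin.lt_def] at hlt ⊢
    omega
  · rintro c' i rfl e' hlt
    have := h.thin_ineq i
    rw [Fin.lt_def] at hlt ⊢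
    rw [← e']
    omega

theorem leftToRightMin (h : Λ.Follows σ) {c : Fin m} (hz : σ c ≤ Λ.z)
    (e : cnt Λ.D c + cnt Λ.L ((σ c).val + 1) = cnt Λ.L (Λ.z.val + 1)) :
    IsLeftToRightMin σ c := by
  have p := h.lower_left_pos e
  have := Λ.le_z
  have := Λ.z_le
  have := Λ.one_le
  refine h.forall_cols ?_ ?_ ?_ ?_ ?_
  · intro c' hc' _ hz' e' hlt
    exact hz.trans_lt hz'
  · intro c' hc' hR e' hlt
    have := h.upper_right_pos e'
    rw [Fin.lt_def] at hlt ⊢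
    omega
  · intro c' hc' _ _ e' hlt
    have := cnt_lt_cnt _ hc' hlt
    have := lt_of_cnt_lt (A := Λ.L) (i := (σ c).val + 1) (j := (σ c').val + 1) (by omega)
    rw [Fin.lt_def]
    omega
  · intro c' hc' hR e' hlt
    have := cnt_lt_cnt _ hc' hlt
    omega
  · rintro c' i rfl e' hlt
    have := h.thin_ineq i
    rw [Fin.lt_def] at hlt ⊢
    rw [← e']
    omega

/-- The upper chain takes right rows from the top and the lower chain from the bottom; as there are
as many non-internal rows as columns, the two portions do not meet. -/
theorem right_lt (_ : Λ.Follows σ) {c d : Fin m} (hc : c ∈ Λ.U) (hd : d ∈ Λ.D)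
    (hdR : σ d ∈ Λ.R)
    (e : cnt Λ.U c + cnt Λ.L (Λ.z.val + 1) + cnt Λ.R ((σ c).val + 1) = Λ.L.card + Λ.R.card)
    (e' : cnt Λ.D d = cnt Λ.L (Λ.z.val + 1) + cnt Λ.R (σ d)) : σ d < σ c := by
  have h1 := cnt_lt_card _ hc
  have h2 := cnt_lt_card _ hd
  have h3 := Λ.card_cols
  have h4 := Λ.card_rows
  have h5 := cnt_succ_of_mem _ hdR
  have := lt_of_cnt_lt (A := Λ.R) (i := (σ d).val + 1) (j := (σ c).val + 1) (by omega)
  rw [Fin.lt_def]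
  omega

theorem rightToLeftMax (h : Λ.Follows σ) {c : Fin m} (hc : c ∈ Λ.U) (hR : σ c ∈ Λ.R)
    (e : cnt Λ.U c + cnt Λ.L (Λ.z.val + 1) + cnt Λ.R ((σ c).val + 1) =
      Λ.L.card + Λ.R.card) : IsRightToLeftMax σ c := by
  have p := h.upper_right_pos e
  have := Λ.le_z
  have := Λ.z_le
  have := Λ.one_le
  have hcR := cnt_succ_of_mem _ hR
  have hcR' := cnt_lt_card _ hR
  refine h.forall_cols ?_ ?_ ?_ ?_ ?_
  · intro c' hc' hL hz' e' hlt
    have := cnt_lt_cnt _ hc hlt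
    have := cnt_lt_card _ hL
    omega
  · intro c' hc' _ e' hlt
    have := cnt_lt_cnt _ hc hlt
    have := lt_of_cnt_lt (A := Λ.R) (i := (σ c').val + 1) (j := (σ c).val + 1) (by omega)
    rw [Fin.lt_def]
    omega
  · intro c' hc' _ _ e' hlt
    have := h.lower_left_pos e'
    rw [Fin.lt_def] at hlt ⊢
    omega
  · intro c' hc' hR' e' _
    exact h.right_lt hc hc' hR' e e'
  · rintro c' i rfl e' hlt
    have := h.thin_ineq i
    rw [Fin.lt_def] at hlt ⊢
    rw [← e']
    omega

theorem rightToLeftMin (h : Λ.Follows σ) {c : Fin m} (hc : c ∈ Λ.D) (hR : σ c ∈ Λ.R)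
    (e : cnt Λ.D c = cnt Λ.L (Λ.z.val + 1) + cnt Λ.R (σ c)) : IsRightToLeftMin σ c := by
  have p := h.lower_right_pos e
  have := Λ.le_z
  have := Λ.z_le
  have := Λ.one_le
  refine h.forall_cols ?_ ?_ ?_ ?_ ?_
  · intro c' hc' _ _ e' hlt
    have := h.upper_left_pos e'
    rw [Fin.lt_def] at hlt ⊢
    omega
  · intro c' hc' _ e' _
    exact h.right_lt hc' hc hR e' e
  · intro c' hc' _ _ e' hlt
    have := cnt_lt_cnt _ hc hlt
    omega
  · intro c' hc' _ e' hlt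
    have := cnt_lt_cnt _ hc hlt
    exact lt_of_cnt_lt (A := Λ.R) (by omega)
  · rintro c' i rfl e' hlt
    have := h.thin_ineq i
    rw [Fin.lt_def] at hlt ⊢
    rw [← e']
    omega

theorem apply_zero (h : Λ.Follows σ) : σ 0 = Λ.z := by
  rcases h.lower 0 Λ.zero_mem_D with ⟨h1, h2, h3⟩ | ⟨h1, h2⟩
  · have : cnt Λ.D ((0 : Fin m) : ℕ) = 0 := by simp [cnt]
    rw [this] at h3
    have e1 := cnt_succ_of_mem _ h1
    have e2 := cnt_succ_of_mem _ Λ.z_mem_L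
    exact eq_of_cnt_eq h1 Λ.z_mem_L (by omega)
  · have : cnt Λ.D ((0 : Fin m) : ℕ) = 0 := by simp [cnt]
    have e2 := cnt_succ_of_mem _ Λ.z_mem_L
    omega

end Follows

omit [NeZero m] in
theorem _root_.AlmostSquare.IsLeftToRightMax.le {σ : Equiv.Perm (Fin m)} {c : Fin m}
    (h : IsLeftToRightMax σ c) : c.val ≤ (σ c).val := by
  have := Finset.card_le_card_of_injOn (s := Finset.Iio c) (t := Finset.Iio (σ c)) σ
    (fun j hj => by simpa using h j (by simpa using hj)) σ.injective.injOn
  simpa using this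

omit [NeZero m] in
theorem _root_.AlmostSquare.IsLeftToRightMin.le {σ : Equiv.Perm (Fin m)} {c : Fin m}
    (h : IsLeftToRightMin σ c) : c.val ≤ m - 1 - (σ c).val := by
  have := Finset.card_le_card_of_injOn (s := Finset.Iio c) (t := Finset.Ioi (σ c)) σ
    (fun j hj => by simpa using h j (by simpa using hj)) σ.injective.injOn
  simpa using this

namespace Follows

theorem upper_left_not_min (h : Λ.Follows σ) {c : Fin m} (hc : c ∈ Λ.U) (hz : Λ.z < σ c) :
    ¬ IsLeftToRightMin σ c := by
  intro hmin
  have : c ≠ 0 := fun e => Λ.disj_col c hc (e ▸ Λ.zero_mem_D)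
  have := hmin 0 (Fin.pos_iff_ne_zero.2 this)
  rw [h.apply_zero] at this
  exact absurd this (not_lt.2 hz.le)

/-- Needed for the precedence to give the intended label. A left-to-right minimum would force row +
column < m, contrary to the position. The top row is on the left chain and so occurs earlier. The
last column is in the lower set, and a lower right point there lies below. -/
theorem upper_right_not (h : Λ.Follows σ) {c : Fin m} (hc : c ∈ Λ.U) (hR : σ c ∈ Λ.R)
    (e : cnt Λ.U c + cnt Λ.L (Λ.z.val + 1) + cnt Λ.R ((σ c).val + 1) =
      Λ.L.card + Λ.R.card) :
    ¬ IsLeftToRightMin σ c ∧ ¬ IsLeftToRightMax σ c ∧ ¬ IsRightToLeftMin σ c := by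
  have p := h.upper_right_pos e
  have := Λ.le_z
  have := Λ.z_le
  have := Λ.one_le
  have hcR := cnt_succ_of_mem _ hR
  have hcR' := cnt_lt_card _ hR
  refine ⟨fun hmin => ?_, fun hmax => ?_, fun hmin => ?_⟩
  · have := hmin.le
    have := (σ c).isLt
    omega
  · obtain ⟨t, ht⟩ := σ.surjective (lastIdx m)
    have hl : (lastIdx m).val + 1 = m := (eq_lastIdx_iff _).1 rfl
    have hne : σ c ≠ lastIdx m := fun h' => Λ.disj_row _ Λ.last_mem_L (h' ▸ hR)
    have key : t < c := by
      revert ht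
      revert t
      refine h.forall_cols ?_ ?_ ?_ ?_ ?_
      · intro c' _ hL' _ e' _
        have := cnt_lt_card _ hL'
        exact lt_of_cnt_lt (A := Λ.U) (by omega)
      · intro c' _ hR' _ ht
        exact absurd (ht ▸ hR') (Λ.disj_row _ Λ.last_mem_L)
      · intro c' _ _ hz _ ht
        rw [ht, Fin.le_def] at hz
        omega
      · intro c' _ hR' _ ht
        exact absurd (ht ▸ hR') (Λ.disj_row _ Λ.last_mem_L)
      · intro c' i _ e' ht
        exact absurd Λ.last_mem_L (ht ▸ e' ▸ Λ.snd_notMem_L i)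
    have := hmax t key
    rw [ht, Fin.lt_def] at this
    have := (σ c).isLt
    omega
  · have hl : (lastIdx m).val + 1 = m := (eq_lastIdx_iff _).1 rfl
    have hne : c ≠ lastIdx m := fun h' => Λ.disj_col c hc (h' ▸ Λ.last_mem_D)
    have hlt : c < lastIdx m := by
      have := Fin.val_ne_of_ne hne
      have := c.isLt
      rw [Fin.lt_def]
      omega
    have h1 := hmin _ hlt
    have c1 := cnt_succ_of_mem _ Λ.last_mem_D
    rw [hl, cnt_eq_card] at c1
    obtain ⟨b1, b2, b3⟩ := Λ.card_bounds
    rcases h.lower _ Λ.last_mem_D with ⟨h2, h3, h4⟩ | ⟨h2, h3⟩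
    · have := cnt_succ_of_mem _ h2
      omega
    · exact absurd (h.right_lt hc Λ.last_mem_D h2 e h3) (not_lt.2 h1.le)

/-- Row 0 is on the lower left chain and so occurs earlier, while a left-to-right maximum would
force column ≤ row, contrary to the position. -/
theorem lower_right_not (h : Λ.Follows σ) {c : Fin m}
    (e : cnt Λ.D c = cnt Λ.L (Λ.z.val + 1) + cnt Λ.R (σ c)) :
    ¬ IsLeftToRightMin σ c ∧ ¬ IsLeftToRightMax σ c := by
  have p := h.lower_right_pos e
  have := Λ.le_z
  have := Λ.z_le
  have := Λ.one_le
  refine ⟨fun hmin => ?_, fun hmax => ?_⟩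
  · obtain ⟨t, ht⟩ := σ.surjective 0
    have key : t < c := by
      revert ht
      revert t
      refine h.forall_cols ?_ ?_ ?_ ?_ ?_
      · intro c' _ _ hz _ ht
        rw [ht] at hz
        exact absurd hz (Fin.not_lt_zero _)
      · intro c' _ hR' _ ht
        exact absurd (ht ▸ hR') (Λ.disj_row _ Λ.zero_mem_L)
      · intro c' _ hL' hz e' ht
        have := cnt_succ_of_mem _ hL'
        exact lt_of_cnt_lt (A := Λ.D) (by omega)
      · intro c' _ hR' _ ht
        exact absurd (ht ▸ hR') (Λ.disj_row _ Λ.zero_mem_L)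
      · intro c' i _ e' ht
        exact absurd Λ.zero_mem_L (ht ▸ e' ▸ Λ.snd_notMem_L i)
    have := hmin t key
    rw [ht] at this
    exact absurd this (Fin.not_lt_zero _)
  · have := hmax.le
    omega

omit [NeZero m] in
theorem exists_mem_window {A : Finset (Fin m)} {s : ℕ} (hA : Balanced A s) {j : ℕ}
    (hj : j + (2 * s + 2) ≤ m) : ∃ c ∈ A, j ≤ c.val ∧ c.val < j + (2 * s + 2) := by
  apply exists_mem_of_cnt_lt
  have h1 := hA j (by omega)
  have h2 := hA _ hj
  omega

/-- Windows of length 2s + 2 on either side of the column contain both an upper and a lower column.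
The margin puts those points above and below the internal one, which excludes all four kinds of
record. -/
theorem isInternal (h : Λ.Follows σ) (i : Fin k) : IsInternal σ (Λ.q i).1 := by
  have ht := h.thin_ineq i
  have e := h.internal i
  have := Λ.le_z
  have := Λ.z_le
  have := Λ.one_le
  have hup : ∀ c ∈ Λ.U, (Λ.q i).1.val ≤ c.val + (2 * Λ.s + 2) →
      c.val ≤ (Λ.q i).1.val + (2 * Λ.s + 2) → (Λ.q i).2 < σ c := by
    intro c hc h1 h2
    rw [Fin.lt_def]
    rcases h.upper c hc with ⟨_, _, h3⟩ | ⟨_, h3⟩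
    · have := h.upper_left_pos h3
      omega
    · have := h.upper_right_pos h3
      omega
  have hlow : ∀ c ∈ Λ.D, (Λ.q i).1.val ≤ c.val + (2 * Λ.s + 2) →
      c.val ≤ (Λ.q i).1.val + (2 * Λ.s + 2) → σ c < (Λ.q i).2 := by
    intro c hc h1 h2
    rw [Fin.lt_def]
    rcases h.lower c hc with ⟨_, _, h3⟩ | ⟨_, h3⟩
    · have := h.lower_left_pos h3
      omega
    · have := h.lower_right_pos h3
      omega
  have hj1 : (Λ.q i).1.val - (2 * Λ.s + 2) + (2 * Λ.s + 2) ≤ m := by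
    have := (Λ.q i).1.isLt
    omega
  have hj2 : (Λ.q i).1.val + 1 + (2 * Λ.s + 2) ≤ m := by omega
  rintro (hmax | hmin | hmax | hmin)
  · obtain ⟨c, hc, h1, h2⟩ := exists_mem_window Λ.balanced_U hj1
    have h3 := hup c hc (by omega) (by omega)
    have := hmax c (by rw [Fin.lt_def]; omega)
    rw [e] at this
    exact absurd this (not_lt.2 h3.le)
  · obtain ⟨c, hc, h1, h2⟩ := exists_mem_window Λ.balanced_D hj1
    have h3 := hlow c hc (by omega) (by omega)
    have := hmin c (by rw [Fin.lt_def]; omega)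
    rw [e] at this
    exact absurd this (not_lt.2 h3.le)
  · obtain ⟨c, hc, h1, h2⟩ := exists_mem_window Λ.balanced_U hj2
    have h3 := hup c hc (by omega) (by omega)
    have := hmax c (by rw [Fin.lt_def]; omega)
    rw [e] at this
    exact absurd this (not_lt.2 h3.le)
  · obtain ⟨c, hc, h1, h2⟩ := exists_mem_window Λ.balanced_D hj2
    have h3 := hlow c hc (by omega) (by omega)
    have := hmin c (by rw [Fin.lt_def]; omega)
    rw [e] at this
    exact absurd this (not_lt.2 h3.le)

theorem upper_spec (h : Λ.Follows σ) {c : Fin m} (hc : c ∈ Λ.U) :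
    IsExternal σ c ∧ IsUpper σ c ∧ (IsLeft σ c ↔ σ c ∈ Λ.L) := by
  rcases h.upper c hc with ⟨h1, h2, h3⟩ | ⟨h1, h2⟩
  · have a := h.leftToRightMax h1 h2 h3
    exact ⟨Or.inl a, ⟨h.upper_left_not_min hc h2, Or.inl a⟩, iff_of_true (Or.inr a) h1⟩
  · have a := h.rightToLeftMax hc h1 h2
    obtain ⟨n1, n2, n3⟩ := h.upper_right_not hc h1 h2
    exact ⟨Or.inr (Or.inr (Or.inl a)), ⟨n1, Or.inr n3⟩,
      iff_of_false (not_or.2 ⟨n1, n2⟩) fun hL => Λ.disj_row _ hL h1⟩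

theorem lower_spec (h : Λ.Follows σ) {c : Fin m} (hc : c ∈ Λ.D) :
    IsExternal σ c ∧ ¬ IsUpper σ c ∧ (IsLeft σ c ↔ σ c ∈ Λ.L) := by
  rcases h.lower c hc with ⟨h1, h2, h3⟩ | ⟨h1, h2⟩
  · have a := h.leftToRightMin h2 h3
    exact ⟨Or.inr (Or.inl a), fun hU => hU.1 a, iff_of_true (Or.inl a) h1⟩
  · have a := h.rightToLeftMin hc h1 h2
    obtain ⟨n1, n2⟩ := h.lower_right_not h2
    exact ⟨Or.inr (Or.inr (Or.inr a)), fun hU => hU.2.elim n2 fun n3 => n3 a,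
      iff_of_false (not_or.2 ⟨n1, n2⟩) fun hL => Λ.disj_row _ hL h1⟩

theorem isInternal_iff (h : Λ.Follows σ) (c : Fin m) :
    IsInternal σ c ↔ ∃ i, (Λ.q i).1 = c := by
  constructor
  · intro hc
    rcases Λ.cover_col c with hU | hD | hi
    · exact absurd (h.upper_spec hU).1 hc
    · exact absurd (h.lower_spec hD).1 hc
    · exact hi
  · rintro ⟨i, rfl⟩
    exact h.isInternal i

theorem mem_U_iff (h : Λ.Follows σ) {c : Fin m} (hc : IsExternal σ c) :
    c ∈ Λ.U ↔ IsUpper σ c := by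
  rcases Λ.cover_col c with hU | hD | ⟨i, rfl⟩
  · exact iff_of_true hU (h.upper_spec hU).2.1
  · exact iff_of_false (fun hU => Λ.disj_col c hU hD) (h.lower_spec hD).2.1
  · exact absurd hc (h.isInternal i)

theorem mem_L_iff (h : Λ.Follows σ) {c : Fin m} (hc : IsExternal σ c) :
    σ c ∈ Λ.L ↔ IsLeft σ c := by
  rcases Λ.cover_col c with hU | hD | ⟨i, rfl⟩
  · exact (h.upper_spec hU).2.2.symm
  · exact (h.lower_spec hD).2.2.symm
  · exact absurd hc (h.isInternal i)

theorem card_internalCols (h : Λ.Follows σ) : (internalCols σ).card = k := by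
  have : internalCols σ = Finset.univ.image fun i => (Λ.q i).1 := by
    ext c
    rw [mem_internalCols, h.isInternal_iff]
    simp
  rw [this, Finset.card_image_of_injective _ Λ.inj_fst]
  simp

end Follows
end Layout

/-- Read the layout off the words, overriding them at the boundary: the first and last columns are
made lower, and rows 0, m - 1 and z left. Row z must be free of internal points because column 0 is
to take it. -/
theorem exists_compat {m k : ℕ} [NeZero m] (z : Fin m) (x y : Fin m → Bool)
    (q : Fin k → Fin m × Fin m) (s : ℕ) (hs : s = dev x + dev y + 2 * (k + 3))
    (hz : 20 * s ≤ z.val) (hz' : 20 * s + z.val ≤ m)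
    (hq : q ∈ rookSeqs ((thin m z.val (20 * s)).filter fun a => a.2 ≠ z) k) :
    ∃ σ ∈ startingAt k z, Compat σ x y q := by
  classical
  simp only [rookSeqs, Finset.mem_filter, Finset.mem_univ, true_and] at hq
  obtain ⟨hA, inj1, inj2⟩ := hq
  have hthin : ∀ i, (q i).2.val + 20 * s ≤ (q i).1.val + z.val ∧
      (q i).1.val + 20 * s ≤ (q i).2.val + z.val ∧
      z.val + 20 * s ≤ (q i).1.val + (q i).2.val ∧
      (q i).1.val + (q i).2.val + z.val + 20 * s ≤ 2 * m := by
    intro i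
    simpa [thin] using (hA i).1
  set P := Finset.univ.image fun i => (q i).1 with hP
  set Q := Finset.univ.image fun i => (q i).2 with hQ
  have mP : ∀ c, c ∈ P ↔ ∃ i, (q i).1 = c := fun c => by simp [hP]
  have mQ : ∀ c, c ∈ Q ↔ ∃ i, (q i).2 = c := fun c => by simp [hQ]
  have cP : P.card ≤ k := by
    simpa using Finset.card_image_le (s := Finset.univ) (f := fun i => (q i).1)
  have cQ : Q.card ≤ k := by
    simpa using Finset.card_image_le (s := Finset.univ) (f := fun i => (q i).2)
  have hl : (lastIdx m).val + 1 = m := (eq_lastIdx_iff _).1 rfl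
  have P0 : (0 : Fin m) ∉ P := by
    rw [mP]; rintro ⟨i, hi⟩
    have := hthin i
    rw [hi, Fin.val_zero] at this
    omega
  have Pl : lastIdx m ∉ P := by
    rw [mP]; rintro ⟨i, hi⟩
    have := hthin i
    rw [hi] at this
    omega
  have Q0 : (0 : Fin m) ∉ Q := by
    rw [mQ]; rintro ⟨i, hi⟩
    have := hthin i
    rw [hi, Fin.val_zero] at this
    omega
  have Ql : lastIdx m ∉ Q := by
    rw [mQ]; rintro ⟨i, hi⟩
    have := hthin i
    rw [hi] at this
    omega
  have Qz : z ∉ Q := by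
    rw [mQ]; rintro ⟨i, hi⟩
    exact (hA i).2 hi
  set E := insert 0 (insert (lastIdx m) P) with hE
  set F := insert z (insert 0 (insert (lastIdx m) Q)) with hF
  have cE : E.card ≤ k + 2 :=
    (Finset.card_insert_le _ _).trans (by have := Finset.card_insert_le (lastIdx m) P; omega)
  have cF : F.card ≤ k + 3 := (Finset.card_insert_le _ _).trans (by
    have h1 := Finset.card_insert_le (lastIdx m) Q
    have h2 := Finset.card_insert_le 0 (insert (lastIdx m) Q)
    omega)
  set U := Finset.univ.filter fun c => c ∉ E ∧ x c = true with hU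
  set D := Finset.univ.filter fun c => c ∉ P ∧ c ∉ U with hD
  set R := Finset.univ.filter fun r => r ∉ F ∧ y r = false with hR
  set L := Finset.univ.filter fun r => r ∉ Q ∧ r ∉ R with hL
  have mU : ∀ c, c ∈ U ↔ c ∉ E ∧ x c = true := fun c => by simp [hU]
  have mD : ∀ c, c ∈ D ↔ c ∉ P ∧ c ∉ U := fun c => by simp [hD]
  have mR : ∀ c, c ∈ R ↔ c ∉ F ∧ y c = false := fun c => by simp [hR]
  have mL : ∀ c, c ∈ L ↔ c ∉ Q ∧ c ∉ R := fun c => by simp [hL]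
  have PE : ∀ c ∈ P, c ∈ E := fun c hc => by simp [hE, hc]
  have QF : ∀ c ∈ Q, c ∈ F := fun c hc => by simp [hF, hc]
  have mono : ∀ {A : Finset (Fin m)} {t : ℕ}, Balanced A t → t ≤ s → Balanced A s := by
    intro A t hA hst j hj
    have := hA j hj
    omega
  let Λ : Layout m k :=
    { U := U, D := D, L := L, R := R, q := q, z := z, s := s
      inj_fst := inj1
      inj_snd := inj2
      cover_col := fun c => by rw [← mP, mD]; tauto
      cover_row := fun r => by rw [← mQ, mL]; tauto
      disj_col := fun c hc => by rw [mD]; tauto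
      disj_row := fun c hc => by rw [mL] at hc; exact hc.2
      fst_notMem_U := fun i h => ((mU _).1 h).1 (PE _ ((mP _).2 ⟨i, rfl⟩))
      fst_notMem_D := fun i h => ((mD _).1 h).1 ((mP _).2 ⟨i, rfl⟩)
      snd_notMem_L := fun i h => ((mL _).1 h).1 ((mQ _).2 ⟨i, rfl⟩)
      snd_notMem_R := fun i h => ((mR _).1 h).1 (QF _ ((mQ _).2 ⟨i, rfl⟩))
      zero_mem_D := (mD _).2 ⟨P0, fun h => ((mU _).1 h).1 (by simp [hE])⟩
      last_mem_D := (mD _).2 ⟨Pl, fun h => ((mU _).1 h).1 (by simp [hE])⟩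
      zero_mem_L := (mL _).2 ⟨Q0, fun h => ((mR _).1 h).1 (by simp [hF])⟩
      last_mem_L := (mL _).2 ⟨Ql, fun h => ((mR _).1 h).1 (by simp [hF])⟩
      z_mem_L := (mL _).2 ⟨Qz, fun h => ((mR _).1 h).1 (by simp [hF])⟩
      balanced_U := mono (balanced_of_label x true U E cE fun c hc => by
        rw [mU]; tauto) (by omega)
      balanced_D := mono (balanced_of_label x false D E cE fun c hc => by
        have := fun h => hc (PE c h)
        rw [mD, mU, ← Bool.not_eq_true]; tauto) (by omega)
      balanced_L := mono (balanced_of_label y true L F cF fun c hc => by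
        have := fun h => hc (QF c h)
        rw [mL, mR, ← Bool.not_eq_false]; tauto) (by omega)
      balanced_R := mono (balanced_of_label y false R F cF fun c hc => by
        rw [mR]; tauto) (by omega)
      one_le := by omega
      le_z := hz
      z_le := hz'
      thin := fun i => (hA i).1 }
  obtain ⟨σ, hσ⟩ := Λ.exists_follows
  refine ⟨σ, ?_, inj1, hσ.isInternal_iff, fun i => (hσ.internal i).symm, ?_, ?_⟩
  · simp only [startingAt, Finset.mem_filter, Finset.mem_univ, true_and]
    exact ⟨hσ.card_internalCols, hσ.apply_zero⟩
  · intro c hc h0 h1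
    rw [← hσ.mem_U_iff hc]
    have : c ∉ E := by
      simp only [hE, Finset.mem_insert, eq_zero_iff_val, eq_lastIdx_iff, not_or]
      exact ⟨h0, h1, fun h => (hσ.isInternal_iff c).2 ((mP c).1 h) hc⟩
    exact ⟨fun h => (mU c).2 ⟨this, h⟩, fun h => ((mU c).1 h).2⟩
  · intro c hc h0 h1 h2
    rw [← hσ.mem_L_iff hc]
    have hQc : σ c ∉ Q := by
      rw [mQ]
      rintro ⟨i, hi⟩
      have : (q i).1 = c := σ.injective ((hσ.internal i).trans hi)
      exact (hσ.isInternal_iff c).2 ⟨i, this⟩ hc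
    have : σ c ∉ F := by
      simp only [hF, Finset.mem_insert, eq_zero_iff_val (σ c), eq_lastIdx_iff, not_or]
      refine ⟨fun h => h0 ?_, h1, h2, hQc⟩
      have h0 : σ 0 = z := hσ.apply_zero
      rw [← h0] at h
      exact (eq_zero_iff_val c).1 (σ.injective h)
    constructor
    · intro h
      refine (mL _).2 ⟨hQc, fun h' => ?_⟩
      rw [((mR _).1 h').2] at h
      exact absurd h (by simp)
    · intro h
      by_contra h'
      exact ((mL _).1 h).2 ((mR _).2 ⟨this, by simpa using h'⟩)

/-! ### A discrete beta integral. -/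

/-- This classifies the subsets of size k + l + 1 of m + 1 points by the element with exactly k
smaller ones; Pascal's rule gives the induction. -/
theorem sum_choose_mul_choose (m k l : ℕ) :
    ∑ i ∈ Finset.range (m + 1), i.choose k * (m - i).choose l = (m + 1).choose (k + l + 1) := by
  induction m generalizing k with
  | zero => cases k <;> cases l <;> simp [Nat.choose_eq_zero_of_lt]
  | succ m ih =>
    rw [Finset.sum_range_succ']
    simp only [Nat.add_sub_add_right, Nat.sub_zero]
    rcases k with _ | k
    · have := ih 0
      simp only [Nat.choose_zero_right, one_mul, zero_add] at this ⊢
      rw [this, Nat.choose_succ_succ (m + 1) l, add_comm]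
    · simp only [Nat.choose_succ_succ _ k, add_mul, Finset.sum_add_distrib, Nat.choose_zero_succ,
        zero_mul, add_zero]
      rw [ih k, ih (k + 1), show k + 1 + l + 1 = (k + l + 1) + 1 by ring,
        Nat.choose_succ_succ (m + 1)]

theorem factorial_mul_choose_le_pow (n k : ℕ) : k.factorial * n.choose k ≤ n ^ k := by
  rw [← Nat.descFactorial_eq_factorial_mul_choose]
  exact Nat.descFactorial_le_pow n k

theorem pow_le_factorial_mul_choose (n k : ℕ) : n ^ k ≤ k.factorial * (n + k).choose k := by
  rw [← Nat.descFactorial_eq_factorial_mul_choose]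
  refine le_trans ?_ (Nat.pow_sub_le_descFactorial (n + k) k)
  gcongr
  omega

theorem le_sum_pow (m k : ℕ) :
    (k.factorial : ℝ) ^ 2 / (2 * k + 1).factorial * ((m - 2 * k : ℕ) : ℝ) ^ (2 * k + 1) ≤
      ∑ z : Fin m, ((z.val : ℝ) * (m - z.val)) ^ k := by
  rcases m with _ | m
  · simp
  have h1 : (k.factorial : ℝ) ^ 2 * (m + 1).choose (2 * k + 1) ≤
      ∑ z : Fin (m + 1), ((z.val : ℝ) * ((m + 1 : ℕ) - z.val)) ^ k := by
    have e := sum_choose_mul_choose m k k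
    rw [show k + k + 1 = 2 * k + 1 by ring] at e
    rw [← e, Fin.sum_univ_eq_sum_range (fun i => ((i : ℝ) * ((m + 1 : ℕ) - i)) ^ k)]
    push_cast
    rw [Finset.mul_sum]
    apply Finset.sum_le_sum
    intro i hi
    have hi' : i ≤ m := by simpa [Nat.lt_succ_iff] using hi
    have a1 : (k.factorial * i.choose k : ℝ) ≤ (i : ℝ) ^ k := by
      exact_mod_cast factorial_mul_choose_le_pow i k
    have a2 : (k.factorial * (m - i).choose k : ℝ) ≤ ((m : ℝ) + 1 - i) ^ k := by
      have : (k.factorial * (m - i).choose k : ℝ) ≤ ((m - i : ℕ) : ℝ) ^ k := by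
        exact_mod_cast factorial_mul_choose_le_pow (m - i) k
      refine this.trans ?_
      gcongr
      rw [Nat.cast_sub hi']
      linarith
    rw [mul_pow]
    calc _ = (k.factorial * i.choose k : ℝ) * (k.factorial * (m - i).choose k : ℝ) := by ring
      _ ≤ _ := by gcongr
  refine le_trans ?_ h1
  rw [div_mul_eq_mul_div, div_le_iff₀ (by positivity), mul_assoc]
  gcongr
  have h2 : (m + 1 - 2 * k) ^ (2 * k + 1) ≤ (2 * k + 1).factorial * (m + 1).choose (2 * k + 1) := by
    rw [← Nat.descFactorial_eq_factorial_mul_choose]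
    refine le_trans ?_ (Nat.pow_sub_le_descFactorial (m + 1) (2 * k + 1))
    exact Nat.pow_le_pow_left (by omega) _
  have h3 : ((m + 1 - 2 * k : ℕ) : ℝ) ^ (2 * k + 1) ≤
      (2 * k + 1).factorial * (m + 1).choose (2 * k + 1) := by exact_mod_cast h2
  linarith

/-- Powers are bounded above by k! times binomials shifted by k, which embeds the sum in the
convolution for m + 2k. -/
theorem sum_pow_le (m k : ℕ) :
    ∑ z : Fin m, ((z.val : ℝ) * (m - z.val)) ^ k ≤
      (k.factorial : ℝ) ^ 2 / (2 * k + 1).factorial * ((m + 2 * k + 1 : ℕ) : ℝ) ^ (2 * k + 1) := by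
  have h1 : ∑ z : Fin m, ((z.val : ℝ) * (m - z.val)) ^ k ≤
      (k.factorial : ℝ) ^ 2 * (m + 2 * k + 1).choose (2 * k + 1) := by
    have e := sum_choose_mul_choose (m + 2 * k) k k
    rw [show k + k + 1 = 2 * k + 1 by ring] at e
    have hsub : ∑ i ∈ Finset.range m, (i + k).choose k * (m + 2 * k - (i + k)).choose k ≤
        (m + 2 * k + 1).choose (2 * k + 1) := by
      rw [← e]
      refine (Finset.sum_map (Finset.range m) (addRightEmbedding k)
        (fun i => i.choose k * (m + 2 * k - i).choose k)).symm.le.trans ?_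
      apply Finset.sum_le_sum_of_subset
      intro i hi
      simp only [Finset.mem_map, Finset.mem_range, addRightEmbedding_apply] at hi ⊢
      omega
    rw [Fin.sum_univ_eq_sum_range (fun i => ((i : ℝ) * (m - i)) ^ k)]
    have hsub' : ((∑ i ∈ Finset.range m, (i + k).choose k * (m + 2 * k - (i + k)).choose k : ℕ) : ℝ)
        ≤ (m + 2 * k + 1).choose (2 * k + 1) := by exact_mod_cast hsub
    refine le_trans ?_ (mul_le_mul_of_nonneg_left hsub' (by positivity))
    push_cast
    rw [Finset.mul_sum]
    apply Finset.sum_le_sum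
    intro i hi
    have hi' : i < m := by simpa using hi
    have a1 : (i : ℝ) ^ k ≤ k.factorial * (i + k).choose k := by
      exact_mod_cast pow_le_factorial_mul_choose i k
    have a2 : ((m : ℝ) - i) ^ k ≤ k.factorial * (m + 2 * k - (i + k)).choose k := by
      have := pow_le_factorial_mul_choose (m - i) k
      rw [show m - i + k = m + 2 * k - (i + k) by omega] at this
      rw [← Nat.cast_sub hi'.le]
      exact_mod_cast this
    rw [mul_pow]
    have h0 : (0 : ℝ) ≤ (m : ℝ) - i := by
      rw [← Nat.cast_sub hi'.le]; positivity
    calc _ ≤ (k.factorial * (i + k).choose k : ℝ) *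
          (k.factorial * (m + 2 * k - (i + k)).choose k : ℝ) := by gcongr
      _ = _ := by ring
  refine h1.trans ?_
  rw [div_mul_eq_mul_div, le_div_iff₀ (by positivity), mul_assoc]
  gcongr
  have h2 : ((2 * k + 1).factorial * (m + 2 * k + 1).choose (2 * k + 1) : ℝ) ≤
      ((m + 2 * k + 1 : ℕ) : ℝ) ^ (2 * k + 1) := by
    exact_mod_cast factorial_mul_choose_le_pow (m + 2 * k + 1) (2 * k + 1)
  linarith

/-- The ratio between a power of `4` and a central binomial coefficient is subexponential. -/
theorem one_le_twelve_pow_mul (k : ℕ) :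
    1 ≤ (12 : ℝ) ^ k * ((k.factorial : ℝ) ^ 2 / (2 * k + 1).factorial) := by
  induction k with
  | zero => simp
  | succ k ih =>
    have e : (12 : ℝ) ^ (k + 1) * (((k + 1).factorial : ℝ) ^ 2 / (2 * (k + 1) + 1).factorial) =
        (12 : ℝ) ^ k * ((k.factorial : ℝ) ^ 2 / (2 * k + 1).factorial) *
          (12 * (k + 1) ^ 2 / ((2 * k + 3) * (2 * k + 2))) := by
      rw [show 2 * (k + 1) + 1 = (2 * k + 1) + 1 + 1 by ring, Nat.factorial_succ k,
        Nat.factorial_succ (2 * k + 1 + 1), Nat.factorial_succ (2 * k + 1)]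
      push_cast
      have : ((2 * k + 1).factorial : ℝ) ≠ 0 := by positivity
      field_simp
      ring
    rw [e]
    refine one_le_mul_of_one_le_of_one_le ih ?_
    rw [one_le_div (by positivity)]
    nlinarith

/-! ### Explicit upper and lower bounds for each size. -/

section Finite
variable {m : ℕ}

/-- The area of the tilted rectangle with left corner `(0, z)`. -/
noncomputable def area (z : Fin m) : ℝ := 2 * z.val * (m - z.val)

theorem area_nonneg (z : Fin m) : 0 ≤ area z := by
  have : (z.val : ℝ) ≤ m := by exact_mod_cast z.isLt.le
  have : (0 : ℝ) ≤ m - z.val := by linarith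
  unfold area
  positivity

/-- The starting values far from both ends. -/
noncomputable def midPoints (m : ℕ) (ε : ℝ) : Finset (Fin m) :=
  Finset.univ.filter fun z => ε * m ≤ z.val ∧ (z.val : ℝ) ≤ m - ε * m

theorem le_area_of_mem {ε : ℝ} (hε : ε ≤ 1 / 2) (hε0 : 0 < ε) {z : Fin m}
    (hz : z ∈ midPoints m ε) : ε * m ^ 2 ≤ area z := by
  simp only [midPoints, Finset.mem_filter, Finset.mem_univ, true_and] at hz
  have h := mul_nonneg (sub_nonneg.2 hz.1) (sub_nonneg.2 hz.2)
  have h2 : 0 ≤ ε * (m : ℝ) ^ 2 * (1 - 2 * ε) := by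
    have : 0 ≤ 1 - 2 * ε := by linarith
    positivity
  unfold area
  nlinarith

theorem area_le_of_notMem {ε : ℝ} (hε0 : 0 < ε) {z : Fin m} (hz : z ∉ midPoints m ε) :
    area z ≤ 2 * ε * m ^ 2 := by
  simp only [midPoints, Finset.mem_filter, Finset.mem_univ, true_and, not_and_or, not_le] at hz
  have h1 : (z.val : ℝ) ≤ m := by exact_mod_cast z.isLt.le
  have h0 : (0 : ℝ) ≤ z.val := by positivity
  unfold area
  have h3 : 0 ≤ ε * m := by positivity
  rcases hz with h | h <;> nlinarith

theorem card_compl_midPoints_le {ε : ℝ} (hε0 : 0 < ε) :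
    (((midPoints m ε)ᶜ.card : ℕ) : ℝ) ≤ 2 * (ε * m + 1) := by
  set N := ⌈ε * m⌉₊ with hN
  have hsub : (midPoints m ε)ᶜ ⊆ (Finset.univ.filter fun z : Fin m => z.val < N) ∪
      (Finset.univ.filter fun z : Fin m => z.rev.val < N) := by
    intro z hz
    simp only [midPoints, Finset.mem_compl, Finset.mem_filter, Finset.mem_univ, true_and,
      not_and_or, not_le] at hz
    simp only [Finset.mem_union, Finset.mem_filter, Finset.mem_univ, true_and, hN, Nat.lt_ceil]
    rcases hz with h | h
    · exact Or.inl h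
    · refine Or.inr ?_
      rw [Fin.val_rev, Nat.cast_sub (by omega)]
      push_cast
      linarith
  have h1 : (Finset.univ.filter fun z : Fin m => z.val < N).card ≤ N := by
    rw [Fin.card_filter_val_lt]; exact min_le_right _ _
  have h2 : (Finset.univ.filter fun z : Fin m => z.rev.val < N).card ≤ N := by
    refine le_trans ?_ h1
    apply Finset.card_le_card_of_injOn Fin.rev
    · intro z hz
      simpa using hz
    · exact Fin.rev_injective.injOn
  have h3 := (Finset.card_le_card hsub).trans (Finset.card_union_le _ _)
  have h4 : (((midPoints m ε)ᶜ.card : ℕ) : ℝ) ≤ 2 * N := by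
    exact_mod_cast (by omega : (midPoints m ε)ᶜ.card ≤ 2 * N)
  have h5 : (N : ℝ) < ε * m + 1 := Nat.ceil_lt_add_one (by positivity)
  linarith

variable [NeZero m] {k : ℕ}

theorem card_fat_pow_le (hk : k ≤ m) {ε B : ℝ} (hε0 : 0 < ε) (z : Fin m) (hB : area z ≤ B)
    (hB' : ε * m ^ 2 ≤ B) (x y : Fin m → Bool) :
    ((fat m z.val (5 * (dev x + dev y + 2 * (k + 3)) + 5)).card : ℝ) ^ k ≤
      B ^ k * Real.exp (205 * k / (ε * m) * (5 * (dev x + dev y) + (10 * k + 35))) := by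
  have hm : 1 ≤ m := NeZero.one_le
  have hm' : (0 : ℝ) < m := by exact_mod_cast hm
  have hx := dev_le x
  have hy := dev_le y
  -- Each deviation is at most 2m and k ≤ m, so the width is at most 20m + 10m + 35m = 65m; then 10
  -- + 3 · 65 = 205.
  have h := card_fat_le_real m z.val (5 * (dev x + dev y + 2 * (k + 3)) + 5) 65 z.isLt.le hm
    (by omega) (by omega)
  push_cast at h
  set s : ℝ := 5 * (dev x + dev y) + (10 * k + 35) with hs
  have hs0 : 0 ≤ s := by positivity
  have e : (5 * ((dev x : ℝ) + dev y + 2 * (k + 3)) + 5) = s := by rw [hs]; ring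
  rw [e] at h
  set t : ℝ := 205 * s / (ε * m) with ht
  have ht0 : 0 ≤ t := by positivity
  have h1 : ((fat m z.val (5 * (dev x + dev y + 2 * (k + 3)) + 5)).card : ℝ) ≤
      B * Real.exp t := by
    calc _ ≤ area z + 205 * m * s := by
          unfold area
          calc _ ≤ _ := h
            _ = _ := by ring
      _ ≤ B + ε * m ^ 2 * t := by
          have : ε * m ^ 2 * t = 205 * m * s := by rw [ht]; field_simp
          linarith
      _ ≤ B + B * t := by gcongr
      _ = B * (t + 1) := by ring
      _ ≤ B * Real.exp t := by
          have : 0 ≤ B := (by positivity : 0 ≤ ε * (m : ℝ) ^ 2).trans hB'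
          gcongr
          exact Real.add_one_le_exp t
  calc _ ≤ (B * Real.exp t) ^ k := by gcongr
    _ = _ := by
        rw [mul_pow, ← Real.exp_nat_mul]
        congr 2
        rw [ht]; ring

theorem card_startingAt_le_real (hk : k ≤ m) (hm : 2 ≤ m) {ε B : ℝ} (hε0 : 0 < ε) (z : Fin m)
    (hB : area z ≤ B) (hB' : ε * m ^ 2 ≤ B) (f : ℕ)
    (hf : ∀ σ ∈ startingAt k z, f ≤ (freeRows σ).card) :
    ((startingAt k z).card : ℝ) * (2 ^ (k + 2) * (2 ^ f * k.factorial)) ≤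
      B ^ k * ∑ x : Fin m → Bool, ∑ y : Fin m → Bool,
        Real.exp (205 * k / (ε * m) * (5 * (dev x + dev y) + (10 * k + 35))) := by
  have h : ((startingAt k z).card : ℝ) * (2 ^ (k + 2) * (2 ^ f * k.factorial)) ≤
      ∑ x : Fin m → Bool, ∑ y : Fin m → Bool,
        ((fat m z.val (5 * (dev x + dev y + 2 * (k + 3)) + 5)).card : ℝ) ^ k := by
    exact_mod_cast card_startingAt_le hm k f z hf
  refine h.trans ?_
  simp only [Finset.mul_sum]
  gcongr with x _ y _
  exact card_fat_pow_le hk hε0 z hB hB' x y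

/-- Middle starts have k + 3 free rows. For the others only k + 2 are guaranteed, which doubles
their bound, and there are at most 2(εm + 1) of them: hence the factor 4. -/
theorem sum_startingAt_le (hk : k ≤ m) {ε : ℝ} (hε0 : 0 < ε) (hε : ε ≤ 1 / 2)
    (hm : 1 < ε * m) :
    32 * 4 ^ k * (k.factorial : ℝ) * ∑ z : Fin m, ((startingAt k z).card : ℝ) ≤
      (∑ x : Fin m → Bool, ∑ y : Fin m → Bool,
        Real.exp (205 * k / (ε * m) * (5 * (dev x + dev y) + (10 * k + 35)))) *
      (∑ z : Fin m, area z ^ k + 4 * (ε * m + 1) * (2 * ε * m ^ 2) ^ k) := by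
  set E := ∑ x : Fin m → Bool, ∑ y : Fin m → Bool,
        Real.exp (205 * k / (ε * m) * (5 * (dev x + dev y) + (10 * k + 35))) with hE
  have hE0 : 0 ≤ E := by positivity
  have hm2 : 2 ≤ m := by
    have : (2 : ℝ) ≤ m := by nlinarith [(Nat.cast_nonneg m : (0 : ℝ) ≤ m)]
    exact_mod_cast this
  have e4 : (4 : ℝ) ^ k = 2 ^ k * 2 ^ k := by rw [← mul_pow]; norm_num
  have hmid : ∀ z ∈ midPoints m ε,
      32 * 4 ^ k * (k.factorial : ℝ) * ((startingAt k z).card : ℝ) ≤ E * area z ^ k := by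
    intro z hz
    have h := card_startingAt_le_real hk hm2 hε0 z le_rfl (le_area_of_mem hε hε0 hz) (k + 3) (by
      intro σ hσ
      simp only [startingAt, Finset.mem_filter, Finset.mem_univ, true_and] at hσ
      refine (card_freeRows σ hm2 hσ.1 ?_ ?_).ge
      · rw [hσ.2]
        intro h0
        simp only [midPoints, Finset.mem_filter, Finset.mem_univ, true_and, h0] at hz
        have := hz.1
        push_cast at this
        linarith
      · rw [hσ.2]
        intro h0
        simp only [midPoints, Finset.mem_filter, Finset.mem_univ, true_and] at hz
        have h0' : (z.val : ℝ) + 1 = m := by exact_mod_cast h0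
        linarith [hz.2])
    calc _ = ((startingAt k z).card : ℝ) * (2 ^ (k + 2) * (2 ^ (k + 3) * k.factorial)) := by
          rw [e4]; ring
      _ ≤ _ := h
      _ = _ := mul_comm _ _
  have hend : ∀ z ∈ (midPoints m ε)ᶜ,
      32 * 4 ^ k * (k.factorial : ℝ) * ((startingAt k z).card : ℝ) ≤
        E * (2 * (2 * ε * m ^ 2) ^ k) := by
    intro z hz
    have hB' : ε * (m : ℝ) ^ 2 ≤ 2 * ε * m ^ 2 := by
      have : 0 ≤ ε * (m : ℝ) ^ 2 := by positivity
      linarith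
    have h := card_startingAt_le_real hk hm2 hε0 z
      (area_le_of_notMem hε0 (Finset.mem_compl.1 hz)) hB' (k + 2) (by
      intro σ hσ
      simp only [startingAt, Finset.mem_filter, Finset.mem_univ, true_and] at hσ
      exact le_card_freeRows σ hm2 hσ.1)
    calc _ = 2 * (((startingAt k z).card : ℝ) *
            (2 ^ (k + 2) * (2 ^ (k + 2) * k.factorial))) := by rw [e4]; ring
      _ ≤ _ := mul_le_mul_of_nonneg_left h zero_le_two
      _ = _ := by ring
  rw [Finset.mul_sum, ← Finset.sum_add_sum_compl (midPoints m ε)]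
  calc _ ≤ ∑ z ∈ midPoints m ε, E * area z ^ k +
        ∑ z ∈ (midPoints m ε)ᶜ, E * (2 * (2 * ε * m ^ 2) ^ k) :=
        add_le_add (Finset.sum_le_sum hmid) (Finset.sum_le_sum hend)
    _ = E * (∑ z ∈ midPoints m ε, area z ^ k +
          ((midPoints m ε)ᶜ.card : ℝ) * (2 * (2 * ε * m ^ 2) ^ k)) := by
        rw [← Finset.mul_sum, Finset.sum_const, nsmul_eq_mul]; ring
    _ ≤ E * (∑ z : Fin m, area z ^ k + 2 * (ε * m + 1) * (2 * (2 * ε * m ^ 2) ^ k)) := by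
        gcongr
        · intro z _ _
          exact pow_nonneg (area_nonneg z) _
        · exact Finset.subset_univ _
        · exact card_compl_midPoints_le hε0
    _ = _ := by ring

/-- Bernoulli's inequality; when E > w and k > 0 the left side is not positive. -/
theorem mul_one_sub_le_pow {w E : ℝ} (hw : 0 < w) (k : ℕ) {a : ℝ}
    (ha : w - E ≤ a) (ha0 : 0 ≤ a) : w ^ k * (1 - k * (E / w)) ≤ a ^ k := by
  by_cases h : E ≤ w
  · have h1 : 1 + (k : ℝ) * (-(E / w)) ≤ (1 + -(E / w)) ^ k := by
      apply one_add_mul_le_pow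
      have : E / w ≤ 1 := (div_le_one hw).2 h
      linarith
    calc _ = w ^ k * (1 + (k : ℝ) * (-(E / w))) := by ring
      _ ≤ w ^ k * (1 + -(E / w)) ^ k := by gcongr
      _ = (w - E) ^ k := by rw [← mul_pow]; congr 1; field_simp; ring
      _ ≤ a ^ k := by
        have : 0 ≤ w - E := by linarith
        gcongr
  · rcases Nat.eq_zero_or_pos k with rfl | hk
    · simp
    · have h1 : 1 ≤ (k : ℝ) * (E / w) := by
        have h2 : 1 ≤ E / w := (one_le_div hw).2 (not_le.1 h).le
        have h3 : (1 : ℝ) ≤ k := by exact_mod_cast hk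
        nlinarith
      have h2 : w ^ k * (1 - k * (E / w)) ≤ 0 :=
        mul_nonpos_of_nonneg_of_nonpos (by positivity) (by linarith)
      exact h2.trans (by positivity)

omit [NeZero m] in
theorem card_thin_filter_ge (z : Fin m) (s : ℕ) (hs : 1 ≤ s) :
    area z - 2 * m * s - m ≤ (((thin m z.val s).filter fun a => a.2 ≠ z).card : ℝ) := by
  have h1 := le_card_thin_real m z.val s z.isLt.le hs
  have h2 : (thin m z.val s).card ≤ ((thin m z.val s).filter fun a => a.2 ≠ z).card + m := by
    have hsub : thin m z.val s ⊆ ((thin m z.val s).filter fun a => a.2 ≠ z) ∪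
        (Finset.univ ×ˢ {z}) := by
      intro a ha
      by_cases h : a.2 = z
      · exact Finset.mem_union_right _
          (Finset.mem_product.2 ⟨Finset.mem_univ _, Finset.mem_singleton.2 h⟩)
      · simp [ha, h]
    have := (Finset.card_le_card hsub).trans (Finset.card_union_le _ _)
    simpa using this
  have h2' : ((thin m z.val s).card : ℝ) ≤
      ((thin m z.val s).filter fun a => a.2 ≠ z).card + m := by exact_mod_cast h2
  unfold area
  linarith

theorem le_card_startingAt {ε : ℝ} (hε0 : 0 < ε) (hε : ε ≤ 1 / 2) (hm : 1 < ε * m) {z : Fin m}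
    (hz : z ∈ midPoints m ε) :
    4 ^ m * (area z ^ k * (1 - (41 * k + 20) / (ε * m) * (16 * √m + (2 * k + 6)))) ≤
      32 * 4 ^ k * (k.factorial : ℝ) * ((startingAt k z).card : ℝ) := by
  have hm' : (0 : ℝ) < m := by exact_mod_cast (NeZero.pos m)
  have hm2 : 2 ≤ m := by
    have : (2 : ℝ) ≤ m := by nlinarith
    exact_mod_cast this
  have hw := le_area_of_mem hε hε0 hz
  have hw0 : 0 < area z := lt_of_lt_of_le (by positivity) hw
  have hz' := hz
  simp only [midPoints, Finset.mem_filter, Finset.mem_univ, true_and] at hz'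
  set s : (Fin m → Bool) → (Fin m → Bool) → ℕ := fun x y => dev x + dev y + 2 * (k + 3) with hs
  set G : (Fin m → Bool) → (Fin m → Bool) → Finset (Fin k → Fin m × Fin m) := fun x y =>
    if 20 * s x y ≤ z.val ∧ 20 * s x y + z.val ≤ m then
      rookSeqs ((thin m z.val (20 * s x y)).filter fun a => a.2 ≠ z) k else ∅ with hG
  have hcount := card_le_startingAt hm2 k z G (by
    intro x y q hq
    simp only [hG] at hq
    split_ifs at hq with hc
    · exact exists_compat z x y q (s x y) rfl hc.1 hc.2 hq
    · simp at hq)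
  have hcount' : ∑ x : Fin m → Bool, ∑ y : Fin m → Bool, ((G x y).card : ℝ) ≤
      ((startingAt k z).card : ℝ) * (2 ^ (k + 2) * (2 ^ (k + 3) * k.factorial)) := by
    exact_mod_cast hcount
  have e4 : (4 : ℝ) ^ k = 2 ^ k * 2 ^ k := by rw [← mul_pow]; norm_num
  have e4m : (4 : ℝ) ^ m = 2 ^ m * 2 ^ m := by rw [← mul_pow]; norm_num
  have hG1 : ∀ x y, area z ^ k * (1 - (41 * k + 20) / (ε * m) * (s x y : ℝ)) ≤
      ((G x y).card : ℝ) := by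
    intro x y
    have hs1 : 2 * k + 6 ≤ s x y := by simp only [hs]; omega
    have hs1' : (2 * k + 6 : ℝ) ≤ s x y := by exact_mod_cast hs1
    by_cases hc : 20 * s x y ≤ z.val ∧ 20 * s x y + z.val ≤ m
    · simp only [hG, if_pos hc]
      set A := (thin m z.val (20 * s x y)).filter fun a => a.2 ≠ z with hA
      have h1 : (((A.card - 2 * k * m : ℕ) : ℝ)) ^ k ≤ ((rookSeqs A k).card : ℝ) := by
        exact_mod_cast pow_le_card_rookSeqs A k k le_rfl
      refine le_trans ?_ h1
      have h2 := card_thin_filter_ge z (20 * s x y) (by omega)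
      rw [← hA] at h2
      have h3 : (A.card : ℝ) - 2 * k * m ≤ ((A.card - 2 * k * m : ℕ) : ℝ) := by
        have : A.card ≤ (A.card - 2 * k * m) + 2 * k * m := by omega
        have : (A.card : ℝ) ≤ ((A.card - 2 * k * m : ℕ) : ℝ) + 2 * k * m := by
          exact_mod_cast this
        linarith
      -- The border costs 2m · 20s; row z and the blocked rows and columns cost (2k + 1)m, at most
      -- ms.
      have h4 : area z - 41 * m * s x y ≤ ((A.card - 2 * k * m : ℕ) : ℝ) := by
        push_cast at h2
        nlinarith
      refine le_trans ?_ (mul_one_sub_le_pow hw0 k h4 (by positivity))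
      have h5 : 41 * m * (s x y : ℝ) / area z ≤ 41 / (ε * m) * s x y := by
        calc _ ≤ 41 * m * (s x y : ℝ) / (ε * m ^ 2) := by gcongr
          _ = _ := by field_simp
      have h6 : (k : ℝ) * (41 * m * (s x y : ℝ) / area z) ≤
          (41 * k + 20) / (ε * m) * (s x y : ℝ) := by
        calc _ ≤ (k : ℝ) * (41 / (ε * m) * s x y) := by gcongr
          _ = (41 * k) / (ε * m) * s x y := by ring
          _ ≤ _ := by gcongr; linarith
      exact mul_le_mul_of_nonneg_left (by linarith) (by positivity)
    -- If the deviation is too large for a layout, the summand 20 in 41k + 20 makes the claimed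
    -- bound nonpositive.
    · have h1 : ε * m ≤ 20 * s x y := by
        rw [not_and_or, not_le, not_le] at hc
        rcases hc with hc | hc
        · have : (z.val : ℝ) < 20 * s x y := by exact_mod_cast hc
          linarith
        · have : (m : ℝ) < 20 * s x y + z.val := by exact_mod_cast hc
          linarith
      have h2 : 1 ≤ (41 * k + 20) / (ε * m) * (s x y : ℝ) := by
        rw [div_mul_eq_mul_div, le_div_iff₀ (by positivity)]
        have : 0 ≤ 41 * (k : ℝ) * s x y := by positivity
        nlinarith
      have h3 : area z ^ k * (1 - (41 * k + 20) / (ε * m) * (s x y : ℝ)) ≤ 0 :=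
        mul_nonpos_of_nonneg_of_nonpos (by positivity) (by linarith)
      exact h3.trans (by positivity)
  calc _ ≤ ∑ x : Fin m → Bool, ∑ y : Fin m → Bool,
        area z ^ k * (1 - (41 * k + 20) / (ε * m) * (s x y : ℝ)) := by
        have hd := sum_dev_add_dev_le m
        have e : ∑ x : Fin m → Bool, ∑ y : Fin m → Bool,
            area z ^ k * (1 - (41 * k + 20) / (ε * m) * (s x y : ℝ)) =
            area z ^ k * (4 ^ m - (41 * k + 20) / (ε * m) *
              (∑ x : Fin m → Bool, ∑ y : Fin m → Bool, ((dev x : ℝ) + dev y) +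
                4 ^ m * (2 * k + 6))) := by
          simp only [hs, ← Finset.mul_sum, Finset.sum_sub_distrib, Nat.cast_add,
            Finset.sum_add_distrib, Finset.sum_const, Finset.card_univ, Fintype.card_pi,
            Fintype.card_bool, Finset.prod_const, Fintype.card_fin, nsmul_eq_mul]
          push_cast
          rw [e4m]
          ring
        rw [e]
        calc _ = area z ^ k * (4 ^ m - (41 * k + 20) / (ε * m) *
              (4 ^ m * (16 * √m) + 4 ^ m * (2 * k + 6))) := by ring
          _ ≤ _ := by gcongr
    _ ≤ ∑ x : Fin m → Bool, ∑ y : Fin m → Bool, ((G x y).card : ℝ) := by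
        gcongr with x _ y _
        exact hG1 x y
    _ ≤ _ := hcount'
    _ = _ := by rw [e4]; ring

theorem le_sum_startingAt {ε : ℝ} (hε0 : 0 < ε) (hε : ε ≤ 1 / 2) (hm : 1 < ε * m)
    (hρ : (41 * k + 20) / (ε * m) * (16 * √m + (2 * k + 6)) ≤ 1) :
    4 ^ m * (1 - (41 * k + 20) / (ε * m) * (16 * √m + (2 * k + 6))) *
      (∑ z : Fin m, area z ^ k - 2 * (ε * m + 1) * (2 * ε * m ^ 2) ^ k) ≤
    32 * 4 ^ k * (k.factorial : ℝ) * ∑ z : Fin m, ((startingAt k z).card : ℝ) := by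
  set ρ := (41 * k + 20) / (ε * m) * (16 * √m + (2 * k + 6)) with hρd
  have h1 : ∑ z : Fin m, area z ^ k - 2 * (ε * m + 1) * (2 * ε * m ^ 2) ^ k ≤
      ∑ z ∈ midPoints m ε, area z ^ k := by
    rw [← Finset.sum_add_sum_compl (midPoints m ε)]
    have : ∑ z ∈ (midPoints m ε)ᶜ, area z ^ k ≤ 2 * (ε * m + 1) * (2 * ε * m ^ 2) ^ k := by
      calc _ ≤ ∑ z ∈ (midPoints m ε)ᶜ, (2 * ε * (m : ℝ) ^ 2) ^ k := by
            apply Finset.sum_le_sum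
            intro z hz
            have := area_nonneg z
            gcongr
            exact area_le_of_notMem hε0 (Finset.mem_compl.1 hz)
        _ = ((midPoints m ε)ᶜ.card : ℝ) * (2 * ε * (m : ℝ) ^ 2) ^ k := by simp
        _ ≤ _ := by
            gcongr
            exact card_compl_midPoints_le hε0
    linarith
  calc _ ≤ 4 ^ m * (1 - ρ) * ∑ z ∈ midPoints m ε, area z ^ k := by
        have : 0 ≤ 1 - ρ := by linarith
        gcongr
    _ = ∑ z ∈ midPoints m ε, 4 ^ m * (area z ^ k * (1 - ρ)) := by
        rw [Finset.mul_sum]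
        apply Finset.sum_congr rfl
        intro z _
        ring
    _ ≤ ∑ z ∈ midPoints m ε, 32 * 4 ^ k * (k.factorial : ℝ) * ((startingAt k z).card : ℝ) := by
        apply Finset.sum_le_sum
        intro z hz
        exact le_card_startingAt hε0 hε hm hz
    _ ≤ _ := by
        rw [Finset.mul_sum]
        apply Finset.sum_le_sum_of_subset_of_nonneg (Finset.subset_univ _)
        intro z _ _
        positivity

omit [NeZero m] in
theorem sum_area_pow (k : ℕ) :
    ∑ z : Fin m, area z ^ k = 2 ^ k * ∑ z : Fin m, ((z.val : ℝ) * (m - z.val)) ^ k := by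
  rw [Finset.mul_sum]
  apply Finset.sum_congr rfl
  intro z _
  rw [← mul_pow, area, mul_assoc]

end Finite
-- Normalisation and passage to the limit.
theorem ncard_ASq (n k : ℕ) [NeZero (n + k)] :
    ((ASq n k).ncard : ℝ) = ∑ z : Fin (n + k), ((startingAt k z).card : ℝ) := by
  classical
  have h1 : ASq n k = ((Finset.univ.filter fun σ : Equiv.Perm (Fin (n + k)) =>
      (internalCols σ).card = k : Finset _) : Set (Equiv.Perm (Fin (n + k)))) := by
    ext σ
    have e1 : {i : Fin (n + k) | IsInternal σ i} = (internalCols σ : Set (Fin (n + k))) := by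
      ext i
      rw [Finset.mem_coe, mem_internalCols]
      rfl
    have e2 : {i : Fin (n + k) | IsExternal σ i} =
        ((internalCols σ)ᶜ : Finset (Fin (n + k))) := by
      ext i
      rw [Finset.mem_coe, Finset.mem_compl, mem_internalCols]
      exact not_not.symm
    have hm : σ ∈ ASq n k ↔ {i : Fin (n + k) | IsExternal σ i}.ncard = n ∧
      {i : Fin (n + k) | IsInternal σ i}.ncard = k := Iff.rfl
    rw [hm, e1, e2, Set.ncard_coe_finset, Set.ncard_coe_finset, Finset.card_compl,
      Fintype.card_fin]
    simp only [Finset.coe_filter, Finset.mem_univ, true_and]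
    constructor
    · exact fun h => h.2
    · intro h
      have h' : (internalCols σ).card = k := h
      exact ⟨by omega, h'⟩
  rw [h1, Set.ncard_coe_finset,
    Finset.card_eq_sum_card_fiberwise (f := fun σ : Equiv.Perm (Fin (n + k)) => σ 0)
      (t := Finset.univ) (fun _ _ => Finset.mem_coe.2 (Finset.mem_univ _))]
  push_cast
  apply Finset.sum_congr rfl
  intro z _
  congr 2
  rw [Finset.filter_filter]
  rfl

theorem ncard_Sq (n : ℕ) : (Sq n).ncard = (ASq n 0).ncard := by
  congr 1
  ext σ
  have e : σ ∈ ASq n 0 ↔ {i : Fin n | IsExternal σ i}.ncard = n ∧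
      {i : Fin n | IsInternal σ i}.ncard = 0 := Iff.rfl
  have e' : σ ∈ Sq n ↔ ∀ i : Fin n, IsExternal σ i := Iff.rfl
  rw [e, e']
  constructor
  · intro h
    have h1 : {i : Fin n | IsExternal σ i} = Set.univ := Set.eq_univ_of_forall h
    have h2 : {i : Fin n | IsInternal σ i} = ∅ :=
      Set.eq_empty_of_forall_notMem fun i hi => hi (h i)
    rw [h1, h2]
    simp
  · rintro ⟨_, h⟩ i
    rw [Set.ncard_eq_zero] at h
    by_contra hi
    exact (Set.eq_empty_iff_forall_notMem.1 h i) hi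

/-- The asymptotic count of almost square permutations. -/
noncomputable def asymCount (n k : ℕ) : ℝ :=
  (k.factorial : ℝ) * 2 ^ (k + 1) * (n : ℝ) ^ (2 * k + 1) * (4 : ℝ) ^ ((n : ℤ) - 3) /
    ((2 * k + 1).factorial : ℝ)

theorem asymCount_pos {n : ℕ} (hn : 0 < n) (k : ℕ) : 0 < asymCount n k := by
  have : (0 : ℝ) < n := by exact_mod_cast hn
  unfold asymCount
  positivity

theorem mul_asymCount (n k : ℕ) :
    32 * 4 ^ k * (k.factorial : ℝ) * asymCount n k =
      4 ^ (n + k) * (2 ^ k * ((k.factorial : ℝ) ^ 2 / (2 * k + 1).factorial) *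
        (n : ℝ) ^ (2 * k + 1)) := by
  unfold asymCount
  rw [zpow_sub₀ (by norm_num), zpow_natCast, pow_succ]
  norm_num
  field_simp
  ring

theorem pow_le_factorial_ratio {ε : ℝ} (h0 : 0 ≤ ε) (h : ε ≤ 1 / 12) (k : ℕ) :
    ε ^ k ≤ (k.factorial : ℝ) ^ 2 / (2 * k + 1).factorial := by
  have h1 := one_le_twelve_pow_mul k
  set g := (k.factorial : ℝ) ^ 2 / (2 * k + 1).factorial
  have hg : 0 ≤ g := by positivity
  calc ε ^ k ≤ ε ^ k * (12 ^ k * g) := le_mul_of_one_le_right (by positivity) h1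
    _ = (12 * ε) ^ k * g := by rw [mul_pow]; ring
    _ ≤ 1 * g := by
        gcongr
        exact pow_le_one₀ (by positivity) (by linarith)
    _ = g := one_mul g

/-- Uses (2k + 1)(3k + 1) = 6k² + 5k + 1 ≤ 11k² + 1, so that only k²/n and 1/n remain. -/
theorem one_add_div_pow_le {n : ℝ} (hn : 0 < n) (k : ℕ) {b : ℝ} (hb : 0 ≤ b)
    (hbk : b ≤ 3 * k + 1) :
    (1 + b / n) ^ (2 * k + 1) ≤ Real.exp (11 * ((k : ℝ) ^ 2 / n) + 1 / n) := by
  have hk : (k : ℝ) ≤ k ^ 2 := by exact_mod_cast Nat.le_self_pow two_ne_zero k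
  calc _ ≤ (Real.exp (b / n)) ^ (2 * k + 1) := by
        gcongr
        rw [add_comm]
        exact Real.add_one_le_exp _
    _ = Real.exp ((2 * k + 1) * b / n) := by
        rw [← Real.exp_nat_mul]; push_cast; congr 1; ring
    _ ≤ _ := by
        rw [Real.exp_le_exp, ← mul_div_assoc, ← add_div]
        gcongr
        nlinarith

/-- The limit profile of the upper bound for the normalized count. -/
noncomputable def upperProfile (ε η a c : ℝ) : ℝ :=
  Real.exp (9225 * a / ε) * (Real.exp (16810000 * a / ε ^ 2 / 2) + η / 2 +
    (Real.exp (2 * (16810000 * a / ε ^ 2)) - 1) / (4 * η)) *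
    ((1 + 4 * (ε + c)) * Real.exp (11 * a + c))

/-- The limit profile of the lower bound for the normalized count. -/
noncomputable def lowerProfile (ε a b c d : ℝ) : ℝ :=
  (1 - (16 * (41 * b + 20 * d) + 368 * a + 120 * c) / ε) *
    (1 - 3 * a - 2 * (ε + c) * Real.exp (11 * a + c))

/-- With θ = 205k/(εm), the deviation enters with weight 5θ, and separating four maxima makes it
20θ, whence 16810000 = 4100². The constant part uses 10k + 35 ≤ 45k for k ≥ 1, whence 9225 = 205 ·
45. -/
theorem sum_exp_le {ε η : ℝ} (hε0 : 0 < ε) (hη : 0 < η) {n : ℕ} (hn : 0 < n) (k : ℕ) :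
    ∑ x : Fin (n + k) → Bool, ∑ y : Fin (n + k) → Bool,
      Real.exp (205 * k / (ε * (n + k : ℕ)) * (5 * (dev x + dev y) + (10 * k + 35))) ≤
    4 ^ (n + k) * (Real.exp (9225 * ((k : ℝ) ^ 2 / n) / ε) *
      (Real.exp (16810000 * ((k : ℝ) ^ 2 / n) / ε ^ 2 / 2) + η / 2 +
        (Real.exp (2 * (16810000 * ((k : ℝ) ^ 2 / n) / ε ^ 2)) - 1) / (4 * η))) := by
  have hn' : (0 : ℝ) < n := by exact_mod_cast hn
  have hk : (k : ℝ) ≤ k ^ 2 := by exact_mod_cast Nat.le_self_pow two_ne_zero k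
  set m := n + k with hm
  have hnm : (n : ℝ) ≤ m := by rw [hm]; push_cast; linarith [(Nat.cast_nonneg k : (0 : ℝ) ≤ k)]
  have hm' : (0 : ℝ) < m := hn'.trans_le hnm
  set θ : ℝ := 205 * k / (ε * m) with hθ
  have e4 : (4 : ℝ) ^ m = 2 ^ m * 2 ^ m := by rw [← mul_pow]; norm_num
  have hT : (m : ℝ) * (4 * (5 * θ)) ^ 2 ≤ 16810000 * ((k : ℝ) ^ 2 / n) / ε ^ 2 := by
    have : (m : ℝ) * (4 * (5 * θ)) ^ 2 = 16810000 * ((k : ℝ) ^ 2 / m) / ε ^ 2 := by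
      rw [hθ]; field_simp; ring
    rw [this]
    gcongr
  have h45 : (k : ℝ) * (10 * k + 35) ≤ 45 * k ^ 2 := by nlinarith
  have hS : θ * (10 * k + 35) ≤ 9225 * ((k : ℝ) ^ 2 / n) / ε := by
    calc θ * (10 * k + 35) = 205 * (k * (10 * k + 35)) / m / ε := by rw [hθ]; field_simp
      _ ≤ 205 * (45 * k ^ 2) / n / ε := by gcongr
      _ = _ := by ring
  calc _ = Real.exp (θ * (10 * k + 35)) * ∑ x : Fin m → Bool, ∑ y : Fin m → Bool,
        Real.exp ((5 * θ) * ((dev x : ℝ) + dev y)) := by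
        simp only [Finset.mul_sum]
        refine Finset.sum_congr rfl fun x _ => Finset.sum_congr rfl fun y _ => ?_
        rw [← Real.exp_add]
        congr 1
        ring
    _ ≤ Real.exp (θ * (10 * k + 35)) * (2 ^ m * (2 ^ m *
          (Real.exp (m * (4 * (5 * θ)) ^ 2 / 2) + η / 2 +
            (Real.exp (2 * (m * (4 * (5 * θ)) ^ 2)) - 1) / (4 * η)))) := by
        gcongr
        refine (sum_exp_dev_add_dev_le (5 * θ) m).trans ?_
        gcongr
        exact sum_exp_maxUp_le (4 * (5 * θ)) η hη m
    _ ≤ Real.exp (9225 * ((k : ℝ) ^ 2 / n) / ε) * (2 ^ m * (2 ^ m *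
          (Real.exp (16810000 * ((k : ℝ) ^ 2 / n) / ε ^ 2 / 2) + η / 2 +
        (Real.exp (2 * (16810000 * ((k : ℝ) ^ 2 / n) / ε ^ 2)) - 1) / (4 * η)))) := by
        gcongr
        have : 1 ≤ Real.exp (2 * (m * (4 * (5 * θ)) ^ 2)) := Real.one_le_exp (by positivity)
        have : 0 ≤ (Real.exp (2 * (m * (4 * (5 * θ)) ^ 2)) - 1) / (4 * η) :=
          div_nonneg (by linarith) (by positivity)
        positivity
    _ = _ := by rw [e4]; ring

theorem ncard_ASq_le {ε η : ℝ} (hε0 : 0 < ε) (hε : ε ≤ 1 / 12) (hη : 0 < η) {n : ℕ} (hn : 0 < n)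
    (k : ℕ) (hnε : 1 < ε * n) :
    ((ASq n k).ncard : ℝ) ≤ asymCount n k * upperProfile ε η ((k : ℝ) ^ 2 / n) (1 / n) := by
  have : NeZero (n + k) := ⟨by omega⟩
  have hn' : (0 : ℝ) < n := by exact_mod_cast hn
  have hk0 : (0 : ℝ) ≤ k := Nat.cast_nonneg k
  have hmε : 1 < ε * ((n + k : ℕ) : ℝ) := by
    push_cast; nlinarith
  have h := sum_startingAt_le (m := n + k) (k := k) (by omega) hε0 (by linarith) hmε
  rw [← ncard_ASq, sum_area_pow] at h
  have h1 := sum_exp_le hε0 hη hn k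
  have h2 := sum_pow_le (n + k) k
  set E := Real.exp (9225 * ((k : ℝ) ^ 2 / n) / ε) *
      (Real.exp (16810000 * ((k : ℝ) ^ 2 / n) / ε ^ 2 / 2) + η / 2 +
        (Real.exp (2 * (16810000 * ((k : ℝ) ^ 2 / n) / ε ^ 2)) - 1) / (4 * η)) with hE
  set g := (k.factorial : ℝ) ^ 2 / (2 * k + 1).factorial with hg
  have hg0 : 0 ≤ g := by positivity
  have hgε : ε ^ k ≤ g := pow_le_factorial_ratio hε0.le hε k
  set X := Real.exp (11 * ((k : ℝ) ^ 2 / n) + 1 / n) with hX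
  have p1 : ((n + k + 2 * k + 1 : ℕ) : ℝ) ^ (2 * k + 1) ≤ (n : ℝ) ^ (2 * k + 1) * X := by
    have e : ((n + k + 2 * k + 1 : ℕ) : ℝ) = n * (1 + (3 * k + 1) / n) := by
      push_cast; field_simp; ring
    rw [e, mul_pow]
    gcongr
    exact one_add_div_pow_le hn' k (by positivity) le_rfl
  have p2 : ((n + k : ℕ) : ℝ) ^ (2 * k + 1) ≤ (n : ℝ) ^ (2 * k + 1) * X := by
    have e : ((n + k : ℕ) : ℝ) = n * (1 + k / n) := by push_cast; field_simp
    rw [e, mul_pow]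
    gcongr
    exact one_add_div_pow_le hn' k hk0 (by linarith)
  set m := n + k with hm
  have hnm : (n : ℝ) ≤ m := by rw [hm]; push_cast; linarith
  have hm' : (0 : ℝ) < m := hn'.trans_le hnm
  have p3 : 4 * (ε * m + 1) * (2 * ε * (m : ℝ) ^ 2) ^ k ≤
      2 ^ k * g * ((n : ℝ) ^ (2 * k + 1) * (4 * (ε + 1 / n) * X)) := by
    calc _ = 2 ^ k * ε ^ k * ((m : ℝ) ^ (2 * k + 1) * (4 * (ε + 1 / m))) := by
          rw [mul_pow, mul_pow, ← pow_mul, pow_succ]; field_simp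
      _ ≤ 2 ^ k * g * (((n : ℝ) ^ (2 * k + 1) * X) * (4 * (ε + 1 / n))) := by gcongr
      _ = _ := by ring
  have hE0 : 0 ≤ E := by
    have : 1 ≤ Real.exp (2 * (16810000 * ((k : ℝ) ^ 2 / n) / ε ^ 2)) :=
      Real.one_le_exp (by positivity)
    have : 0 ≤ (Real.exp (2 * (16810000 * ((k : ℝ) ^ 2 / n) / ε ^ 2)) - 1) / (4 * η) :=
      div_nonneg (by linarith) (by positivity)
    positivity
  have key : 32 * 4 ^ k * (k.factorial : ℝ) * ((ASq n k).ncard : ℝ) ≤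
      32 * 4 ^ k * (k.factorial : ℝ) *
        (asymCount n k * upperProfile ε η ((k : ℝ) ^ 2 / n) (1 / n)) := by
    calc _ ≤ _ := h
      _ ≤ (4 ^ m * E) * (2 ^ k * (g * ((n : ℝ) ^ (2 * k + 1) * X)) +
          2 ^ k * g * ((n : ℝ) ^ (2 * k + 1) * (4 * (ε + 1 / n) * X))) := by
          have h2' : ∑ z : Fin m, ((z.val : ℝ) * (m - z.val)) ^ k ≤
              g * ((n : ℝ) ^ (2 * k + 1) * X) := h2.trans (by gcongr)
          have : 0 ≤ ∑ z : Fin m, ((z.val : ℝ) * (m - z.val)) ^ k := by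
            apply Finset.sum_nonneg
            intro z _
            have : (z.val : ℝ) ≤ m := by exact_mod_cast z.isLt.le
            have : (0 : ℝ) ≤ m - z.val := by linarith
            positivity
          gcongr
      _ = (4 ^ m * (2 ^ k * g * (n : ℝ) ^ (2 * k + 1))) *
          upperProfile ε η ((k : ℝ) ^ 2 / n) (1 / n) := by
          rw [upperProfile, ← hE, ← hX]; ring
      _ = _ := by rw [← mul_asymCount]; ring
  exact le_of_mul_le_mul_left key (by positivity)

theorem le_ncard_ASq {ε : ℝ} (hε0 : 0 < ε) (hε : ε ≤ 1 / 12) {n : ℕ} (hn : 0 < n)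
    (k : ℕ) (hnε : 1 < ε * n) (hkn : k ≤ n)
    (hρ : (16 * (41 * (k / √n) + 20 * (1 / √n)) + 368 * ((k : ℝ) ^ 2 / n) + 120 * (1 / n)) / ε ≤ 1)
    (hpos : 0 ≤ 1 - 3 * ((k : ℝ) ^ 2 / n) -
      2 * (ε + 1 / n) * Real.exp (11 * ((k : ℝ) ^ 2 / n) + 1 / n)) :
    asymCount n k * lowerProfile ε ((k : ℝ) ^ 2 / n) (k / √n) (1 / n) (1 / √n) ≤
      ((ASq n k).ncard : ℝ) := by
  have : NeZero (n + k) := ⟨by omega⟩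
  have hn' : (0 : ℝ) < n := by exact_mod_cast hn
  have hk0 : (0 : ℝ) ≤ k := Nat.cast_nonneg k
  have hk : (k : ℝ) ≤ k ^ 2 := by exact_mod_cast Nat.le_self_pow two_ne_zero k
  have hmε : 1 < ε * ((n + k : ℕ) : ℝ) := by
    push_cast; nlinarith
  have hs0 : 0 < √(n : ℝ) := by positivity
  set ρ := (16 * (41 * (k / √n) + 20 * (1 / √n)) + 368 * ((k : ℝ) ^ 2 / n) + 120 * (1 / n)) / ε
    with hρd
  have hnm : (n : ℝ) ≤ ((n + k : ℕ) : ℝ) := by push_cast; linarith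
  have hm' : (0 : ℝ) < ((n + k : ℕ) : ℝ) := hn'.trans_le hnm
  have hρ' : (41 * k + 20) / (ε * (n + k : ℕ)) * (16 * √(n + k : ℕ) + (2 * k + 6)) ≤ ρ := by
    have hsm : √(n : ℝ) ≤ √((n + k : ℕ) : ℝ) := Real.sqrt_le_sqrt hnm
    have hsm0 : 0 < √((n + k : ℕ) : ℝ) := hs0.trans_le hsm
    have hsq : √((n + k : ℕ) : ℝ) * √((n + k : ℕ) : ℝ) = ((n + k : ℕ) : ℝ) :=
      Real.mul_self_sqrt hm'.le
    generalize ((n + k : ℕ) : ℝ) = M at *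
    calc _ = (16 * ((41 * k + 20) * (√M / M)) + (41 * k + 20) * (2 * k + 6) / M) / ε := by
          field_simp
      _ = (16 * ((41 * k + 20) * (1 / √M)) + (41 * k + 20) * (2 * k + 6) / M) / ε := by
          have : √M / M = 1 / √M := by
            rw [div_eq_div_iff hm'.ne' hsm0.ne', one_mul, hsq]
          rw [this]
      -- (41k + 20)(2k + 6) = 82k² + 286k + 120, and k ≤ k².
      _ ≤ (16 * ((41 * k + 20) * (1 / √n)) + (368 * k ^ 2 + 120) / n) / ε := by
          gcongr
          nlinarith
      _ = ρ := by rw [hρd]; ring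
  have h := le_sum_startingAt (m := n + k) (k := k) hε0 (by linarith) hmε (hρ'.trans hρ)
  rw [← ncard_ASq, sum_area_pow] at h
  have h2 := le_sum_pow (n + k) k
  set g := (k.factorial : ℝ) ^ 2 / (2 * k + 1).factorial with hg
  have hg0 : 0 ≤ g := by positivity
  have hgε : ε ^ k ≤ g := pow_le_factorial_ratio hε0.le hε k
  set X := Real.exp (11 * ((k : ℝ) ^ 2 / n) + 1 / n) with hX
  have p1 : (n : ℝ) ^ (2 * k + 1) * (1 - 3 * ((k : ℝ) ^ 2 / n)) ≤
      ((n + k - 2 * k : ℕ) : ℝ) ^ (2 * k + 1) := by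
    have e : ((n + k - 2 * k : ℕ) : ℝ) = n * (1 + -(k / n)) := by
      rw [show n + k - 2 * k = n - k by omega, Nat.cast_sub hkn]; field_simp; ring
    rw [e, mul_pow]
    gcongr
    have hkn' : (k : ℝ) / n ≤ 1 := by
      rw [div_le_one hn']; exact_mod_cast hkn
    refine le_trans ?_ (one_add_mul_le_pow (by linarith) (2 * k + 1))
    have : (2 * k + 1) * ((k : ℝ) / n) ≤ 3 * (k ^ 2 / n) := by
      rw [← mul_div_assoc, ← mul_div_assoc]
      have : (2 * k + 1) * (k : ℝ) ≤ 3 * k ^ 2 := by nlinarith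
      gcongr
    push_cast
    linarith
  have p2 : ((n + k : ℕ) : ℝ) ^ (2 * k + 1) ≤ (n : ℝ) ^ (2 * k + 1) * X := by
    have e : ((n + k : ℕ) : ℝ) = n * (1 + k / n) := by push_cast; field_simp
    rw [e, mul_pow]
    gcongr
    exact one_add_div_pow_le hn' k hk0 (by linarith)
  set m := n + k with hm
  have p3 : 2 * (ε * m + 1) * (2 * ε * (m : ℝ) ^ 2) ^ k ≤
      2 ^ k * g * ((n : ℝ) ^ (2 * k + 1) * (2 * (ε + 1 / n) * X)) := by
    calc _ = 2 ^ k * ε ^ k * ((m : ℝ) ^ (2 * k + 1) * (2 * (ε + 1 / m))) := by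
          rw [mul_pow, mul_pow, ← pow_mul, pow_succ]; field_simp
      _ ≤ 2 ^ k * g * (((n : ℝ) ^ (2 * k + 1) * X) * (2 * (ε + 1 / n))) := by gcongr
      _ = _ := by ring
  have key : 32 * 4 ^ k * (k.factorial : ℝ) *
        (asymCount n k * lowerProfile ε ((k : ℝ) ^ 2 / n) (k / √n) (1 / n) (1 / √n)) ≤
      32 * 4 ^ k * (k.factorial : ℝ) * ((ASq n k).ncard : ℝ) := by
    refine le_trans ?_ h
    calc _ = 32 * 4 ^ k * (k.factorial : ℝ) * asymCount n k *
          lowerProfile ε ((k : ℝ) ^ 2 / n) (k / √n) (1 / n) (1 / √n) := by ring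
      _ = 4 ^ m * (1 - ρ) * (2 ^ k * g * (n : ℝ) ^ (2 * k + 1) *
          (1 - 3 * ((k : ℝ) ^ 2 / n) - 2 * (ε + 1 / n) * X)) := by
          rw [mul_asymCount, lowerProfile, ← hρd, ← hX]; ring
      _ ≤ _ := by
          have h2' : 2 ^ k * (g * ((n : ℝ) ^ (2 * k + 1) * (1 - 3 * ((k : ℝ) ^ 2 / n)))) ≤
              2 ^ k * ∑ z : Fin m, ((z.val : ℝ) * (m - z.val)) ^ k := by
            gcongr
            refine le_trans ?_ h2
            gcongr
          refine mul_le_mul (by gcongr) (by linarith) (mul_nonneg (by positivity) hpos)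
            (mul_nonneg (by positivity) (sub_nonneg.2 (hρ'.trans hρ)))
  exact le_of_mul_le_mul_left key (by positivity)

theorem tendsto_ratio (k : ℕ → ℕ)
    (hk : (fun n : ℕ => (k n : ℝ)) =o[atTop] (fun n : ℕ => Real.sqrt (n : ℝ))) :
    Tendsto (fun n => ((ASq n (k n)).ncard : ℝ) / asymCount n (k n)) atTop (nhds 1) := by
  have hb : Tendsto (fun n : ℕ => (k n : ℝ) / √n) atTop (nhds 0) := hk.tendsto_div_nhds_zero
  have ha : Tendsto (fun n : ℕ => (k n : ℝ) ^ 2 / n) atTop (nhds 0) := by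
    have := hb.pow 2
    simpa [div_pow] using this
  have hc : Tendsto (fun n : ℕ => (1 : ℝ) / n) atTop (nhds 0) := tendsto_one_div_atTop_nhds_zero_nat
  have hd : Tendsto (fun n : ℕ => (1 : ℝ) / √n) atTop (nhds 0) := by
    have := (Real.tendsto_sqrt_atTop.comp tendsto_natCast_atTop_atTop).inv_tendsto_atTop (𝕜 := ℝ)
    simp only [one_div]
    exact this
  have hεn : ∀ ε : ℝ, 0 < ε → ∀ᶠ n : ℕ in atTop, 1 < ε * n := fun ε hε =>
    (tendsto_natCast_atTop_atTop.const_mul_atTop hε).eventually_gt_atTop 1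
  refine tendsto_order.2 ⟨fun l hl => ?_, fun u hu => ?_⟩
  -- For fixed ε the lower profile tends to 1 - 2ε, so ε is fixed from l before n grows.
  · obtain ⟨ε, hε0, hε, hεl⟩ : ∃ ε : ℝ, 0 < ε ∧ ε ≤ 1 / 12 ∧ l < 1 - 2 * ε :=
      ⟨min (1 / 12) ((1 - l) / 4), lt_min (by norm_num) (by linarith), min_le_left _ _, by
        have := min_le_right (1 / 12) ((1 - l) / 4)
        linarith⟩
    have t1 : Tendsto (fun n : ℕ => (16 * (41 * (k n / √n) + 20 * (1 / √n)) +
        368 * ((k n : ℝ) ^ 2 / n) + 120 * (1 / n)) / ε) atTop (nhds 0) := by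
      have := (((((hb.const_mul 41).add (hd.const_mul 20)).const_mul 16).add
        (ha.const_mul 368)).add (hc.const_mul 120)).div_const ε
      simpa using this
    have t2 : Tendsto (fun n : ℕ => 1 - 3 * ((k n : ℝ) ^ 2 / n) -
        2 * (ε + 1 / n) * Real.exp (11 * ((k n : ℝ) ^ 2 / n) + 1 / n)) atTop
        (nhds (1 - 2 * ε)) := by
      have h1 := (Real.continuous_exp.tendsto _).comp ((ha.const_mul 11).add hc)
      have h2 := (((tendsto_const_nhds (x := ε)).add hc).const_mul 2).mul h1
      have h3 := ((tendsto_const_nhds (x := (1 : ℝ))).sub (ha.const_mul 3)).sub h2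
      simpa using h3
    have t3 : Tendsto (fun n : ℕ => lowerProfile ε ((k n : ℝ) ^ 2 / n) (k n / √n) (1 / n)
        (1 / √n)) atTop (nhds (1 - 2 * ε)) := by
      have := ((tendsto_const_nhds (x := (1 : ℝ))).sub t1).mul t2
      simpa [lowerProfile] using this
    filter_upwards [t1.eventually_le_const zero_lt_one,
      t2.eventually_const_le (show (0 : ℝ) < 1 - 2 * ε by linarith),
      t3.eventually_const_lt hεl, hεn ε hε0, eventually_gt_atTop 0,
      hb.eventually_le_const zero_lt_one] with n h1 h2 h3 h4 h5 h6
    have hn' : (1 : ℝ) ≤ n := by exact_mod_cast h5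
    have hkn : k n ≤ n := by
      rw [div_le_one (by positivity)] at h6
      have : (k n : ℝ) ≤ n := h6.trans (Real.sqrt_le_self_iff.2 (Or.inr hn'))
      exact_mod_cast this
    have hpos := asymCount_pos h5 (k n)
    rw [lt_div_iff₀ hpos]
    calc _ < lowerProfile ε ((k n : ℝ) ^ 2 / n) (k n / √n) (1 / n) (1 / √n) *
          asymCount n (k n) := by gcongr
      _ = _ := mul_comm _ _
      _ ≤ _ := le_ncard_ASq hε0 hε h5 (k n) h4 hkn h1 h2
  · obtain ⟨ε, hε0, hε, hεu⟩ : ∃ ε : ℝ, 0 < ε ∧ ε ≤ 1 / 12 ∧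
        (1 + ε / 2) * (1 + 4 * ε) < u :=
      ⟨min (1 / 12) ((u - 1) / 20), lt_min (by norm_num) (by linarith), min_le_left _ _, by
        have h1 := min_le_right (1 / 12) ((u - 1) / 20)
        have h2 := min_le_left (1 / 12) ((u - 1) / 20)
        have h3 : 0 < min (1 / 12) ((u - 1) / 20) := lt_min (by norm_num) (by linarith)
        nlinarith⟩
    -- Here η = ε: one small parameter controls both the end starts and the sinh term.
    have t : Tendsto (fun n : ℕ => upperProfile ε ε ((k n : ℝ) ^ 2 / n) (1 / n)) atTop
        (nhds ((1 + ε / 2) * (1 + 4 * ε))) := by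
      have hcont : Continuous fun p : ℝ × ℝ => upperProfile ε ε p.1 p.2 := by
        unfold upperProfile
        fun_prop
      have := (hcont.tendsto (0, 0)).comp (ha.prodMk_nhds hc)
      have e : upperProfile ε ε 0 0 = (1 + ε / 2) * (1 + 4 * ε) := by simp [upperProfile]
      rw [← e]
      exact this
    filter_upwards [t.eventually_lt_const hεu, hεn ε hε0, eventually_gt_atTop 0]
      with n h1 h2 h3
    have hpos := asymCount_pos h3 (k n)
    rw [div_lt_iff₀ hpos]
    calc _ ≤ _ := ncard_ASq_le hε0 hε hε0 h3 (k n) h2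
      _ = upperProfile ε ε ((k n : ℝ) ^ 2 / n) (1 / n) * asymCount n (k n) := mul_comm _ _
      _ < _ := by gcongr

end AlmostSquare

theorem theorem1p1 (k : ℕ → ℕ)
    (hk : (fun n : ℕ => (k n : ℝ)) =o[atTop] (fun n : ℕ => Real.sqrt (n : ℝ))) :
    ((fun n : ℕ => ((AlmostSquare.ASq n (k n)).ncard : ℝ)) ~[atTop]
      (fun n : ℕ => ((k n).factorial : ℝ) * 2 ^ (k n + 1) * (n : ℝ) ^ (2 * k n + 1) *
        (4 : ℝ) ^ ((n : ℤ) - 3) / ((2 * k n + 1).factorial : ℝ))) ∧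
    ((fun n : ℕ => ((k n).factorial : ℝ) * 2 ^ (k n + 1) * (n : ℝ) ^ (2 * k n + 1) *
        (4 : ℝ) ^ ((n : ℤ) - 3) / ((2 * k n + 1).factorial : ℝ)) ~[atTop]
      (fun n : ℕ => ((k n).factorial : ℝ) * 2 ^ (k n) * (n : ℝ) ^ (2 * k n) /
        ((2 * k n + 1).factorial : ℝ) * ((AlmostSquare.Sq n).ncard : ℝ))) := by
  have main : ∀ l : ℕ → ℕ, ((fun n : ℕ => (l n : ℝ)) =o[atTop] fun n : ℕ => √(n : ℝ)) →
      (fun n : ℕ => ((AlmostSquare.ASq n (l n)).ncard : ℝ)) ~[atTop]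
        fun n => AlmostSquare.asymCount n (l n) := fun l hl =>
    isEquivalent_of_tendsto_one (AlmostSquare.tendsto_ratio l hl)
  refine ⟨main k hk, ?_⟩
  -- The case k = 0 gives the asymptotics of the all-external permutations, and the two closed forms
  -- differ by exactly the stated factor.
  have h0 := main (fun _ => 0) (by simp)
  have h1 : (fun n : ℕ => AlmostSquare.asymCount n 0) ~[atTop]
      fun n : ℕ => ((AlmostSquare.Sq n).ncard : ℝ) := by
    simp only [AlmostSquare.ncard_Sq]
    exact h0.symm
  have h2 := (IsEquivalent.refl (l := atTop) (u := fun n : ℕ =>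
    ((k n).factorial : ℝ) * 2 ^ (k n) * (n : ℝ) ^ (2 * k n) /
      ((2 * k n + 1).factorial : ℝ))).mul h1
  refine IsEquivalent.congr_left h2 (Eventually.of_forall fun n => ?_)
  simp only [AlmostSquare.asymCount, Pi.mul_apply, Nat.factorial_zero, Nat.cast_one, mul_zero,
    zero_add, pow_one, Nat.factorial_one]
  ring
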